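/- Let $\mathbb{T}=\mathbb{R}/\mathbb{Z}$. There exists a full Lebesgue measure set $\mathcal{F}'\subset\mathbb{T}\times\mathbb{T}^2\times\mathbb{T}^2$ such that for every $(\alpha,\mathbf{p},\mathbf{q})\in\mathcal{F}'$ (with $\alpha$ represented by any real number) the following holds. Let $\varphi:\mathbb{T}^2\to\mathbb{R}_{\ge 0}$ be any $C^3$ function which vanishes at exactly the two distinct points $\mathbf{p}$ and $\mathbf{q}$ and whose Hessians $D^2\varphi(\mathbf{p})$, $D^2\varphi(\mathbf{q})$ are positive definite, and let $(T_t)_{t\in\mathbb{R}}$ be the flow on $\mathbb{T}^2$ generated by the vector field $\varphi\cdot(1,\alpha)$ (which exists). Then the $(T_t)$-invariant Borel probability measures are exactly the convex combinations $c\,\delta_{\mathbf{p}}+(1-c)\,\delta_{\mathbf{q}}$, $c\in[0,1]$, and $(T_t)$ has extreme historic behavior: for Lebesgue-a.e. $\mathbf{x}\in\mathbb{T}^2$, the set of accumulation points, as $t\to\infty$ and in the weak topology, of the empirical measures $$\mu_t(\mathbf{x})(f)=\frac1t\int_0^t f(T_s\mathbf{x})\,\mathrm{d}s,\qquad f\in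 C(\mathbb{T}^2),$$ is exactly the set of $(T_t)$-invariant probability measures. -/

import Mathlib

open MeasureTheory Filter Topology

noncomputable section

namespace TorusFlow

/-- The two-torus `ℝ²/ℤ²`; its `volume` is normalized Lebesgue measure. -/
abbrev Torus2 : Type := UnitAddCircle × UnitAddCircle

/-- The covering projection `ℝ² → 𝕋²`. -/
def proj (v : ℝ × ℝ) : Torus2 := ((v.1 : UnitAddCircle), (v.2 : UnitAddCircle))

/-- The Hessian of `φ` at the point `p` of the torus is positive definite (computed on the universal
cover; by periodicity the choice of the lift `P` of `p` does not matter). -/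
def HasPosDefHessianAt (φ : Torus2 → ℝ) (p : Torus2) : Prop :=
  ∀ P : ℝ × ℝ, proj P = p → ∀ v : ℝ × ℝ, v ≠ 0 →
    0 < fderiv ℝ (fderiv ℝ (fun w : ℝ × ℝ => φ (proj w))) P v v

/-- `φ` is a `C³` non-negative function on the torus which vanishes at exactly the two points
`p` and `q`, with positive definite Hessian at both. -/
structure IsStoppingFunction (φ : Torus2 → ℝ) (p q : Torus2) : Prop where
  contDiff : ContDiff ℝ 3 (fun w : ℝ × ℝ => φ (proj w))
  nonneg : ∀ x, 0 ≤ φ x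
  ne : p ≠ q
  eq_zero_iff : ∀ x, φ x = 0 ↔ x = p ∨ x = q
  hessian_left : HasPosDefHessianAt φ p
  hessian_right : HasPosDefHessianAt φ q

/-- The flow `T` is generated by the vector field `φ · (1, a)`: every orbit lifts to an
integral curve in `ℝ²` of the lifted vector field. -/
def IsGeneratedBy (T : Flow ℝ Torus2) (φ : Torus2 → ℝ) (a : ℝ) : Prop :=
  ∀ x : Torus2, ∃ γ : ℝ → ℝ × ℝ, (∀ t, T t x = proj (γ t)) ∧
    ∀ t, HasDerivAt γ (φ (proj (γ t)) • ((1 : ℝ), a)) t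

/-- The value `μ_t(x)(f) = (1/t) ∫₀ᵗ f (T_s x) ds` of the empirical measure at time `t`. -/
def empirical (T : Flow ℝ Torus2) (x : Torus2) (t : ℝ) (f : C(Torus2, ℝ)) : ℝ :=
  t⁻¹ * ∫ s in (0 : ℝ)..t, f (T s x)

/-- The accumulation points, as `t → ∞` and in the weak topology, of the empirical measures of
the point `x`. -/
def accumulationMeasures (T : Flow ℝ Torus2) (x : Torus2) : Set (Measure Torus2) :=
  {ν | IsProbabilityMeasure ν ∧ ∃ τ : ℕ → ℝ, Tendsto τ atTop atTop ∧
    ∀ f : C(Torus2, ℝ), Tendsto (fun n => empirical T x (τ n) f) atTop (𝓝 (∫ y, f y ∂ν))}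

/-- The `T`-invariant Borel probability measures. -/
def invariantMeasures (T : Flow ℝ Torus2) : Set (Measure Torus2) :=
  {ν | IsProbabilityMeasure ν ∧ ∀ t : ℝ, MeasurePreserving (T t) ν ν}

/-- Extreme historic behavior: for a.e. point, the accumulation points of the empirical measures
are exactly the invariant probability measures. -/
def HasExtremeHistoricBehavior (T : Flow ℝ Torus2) : Prop :=
  ∀ᵐ x : Torus2, accumulationMeasures T x = invariantMeasures T

/-- The convex combinations of `δ_p` and `δ_q`. -/
def diracSegment (p q : Torus2) : Set (Measure Torus2) :=
  {ν | ∃ c : ℝ, 0 ≤ c ∧ c ≤ 1 ∧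
    ν = ENNReal.ofReal c • Measure.dirac p + ENNReal.ofReal (1 - c) • Measure.dirac q}

end TorusFlow

end

/-!
The orbit of `x` under the flow is `x + θ t • (1, a)` for an increasing clock with `θ' = φ`. The
line equidistributes, and `1 / φ` is not integrable because `φ` vanishes quadratically at `p` and
`q`; hence `θ t = o(t)`, the time average of `φ` along the orbit tends to `0`, and every
accumulation point of the empirical measures lies on the segment between `δ_p` and `δ_q`. Since the
empirical measures move continuously in time, once both ends of the segment are accumulation
points, the whole segment is.

The empirical measures accumulate at `δ_p` if infinitely often a single passage near `p` takes far
longer than everything the orbit did near `q` before. A passage at distance `d` takes time of order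
`1 / d`. Over the first `n` passages near `q` the sum of the inverse distances is typically of
order `n log n`, whereas the events that the `n`-th passage near `p` is at distance less than
`η / (n log n)` are pairwise independent with divergent sum of probabilities, so that almost surely
infinitely many of them occur. By Fubini this transfers to almost every `(α, p, q)` and almost every
`x`, and the roles of `p` and `q` may be exchanged.
-/

noncomputable section

namespace TorusFlow

/-! ### Domination and second-order expansion -/

section Domination

variable {X : Type*} [TopologicalSpace X] {f g : X → ℝ}

lemma exists_eventually_le_mul (hf : Continuous f) (hg : Continuous g) {x : X} (hx : 0 < g x) :
    ∃ C, ∀ᶠ y in 𝓝 x, f y ≤ C * g y := by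
  have hlim : Tendsto (fun y => f y / g y) (𝓝 x) (𝓝 (f x / g x)) :=
    hf.continuousAt.div hg.continuousAt hx.ne'
  refine ⟨f x / g x + 1, ?_⟩
  filter_upwards [hlim.eventually_le_const (lt_add_one _), hg.continuousAt.eventually_const_lt hx]
    with y hy hpos
  exact (div_le_iff₀ hpos).1 hy

lemma exists_forall_le_mul [CompactSpace X] (hf : Continuous f) (hg : Continuous g)
    (hg0 : ∀ x, 0 ≤ g x) (h : ∀ x, g x = 0 → ∃ C, ∀ᶠ y in 𝓝 x, f y ≤ C * g y) :
    ∃ C, 0 ≤ C ∧ ∀ x, f x ≤ C * g x := by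
  have hmono {C C' : ℝ} (hC : C ≤ C') {x : X} (hx : f x ≤ C * g x) : f x ≤ C' * g x :=
    hx.trans (mul_le_mul_of_nonneg_right hC (hg0 x))
  have hloc : ∀ x, ∃ C, ∀ᶠ y in 𝓝 x, f y ≤ C * g y := fun x =>
    (hg0 x).eq_or_lt.elim (fun hx => h x hx.symm) (exists_eventually_le_mul hf hg)
  obtain ⟨C, hC⟩ : ∃ C, ∀ x ∈ Set.univ, f x ≤ C * g x := by
    refine isCompact_univ.induction_on (p := fun s => ∃ C, ∀ x ∈ s, f x ≤ C * g x) ⟨0, by simp⟩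
      (fun s t hst ⟨C, hC⟩ => ⟨C, fun x hx => hC x (hst hx)⟩) ?_ fun x _ => ?_
    · rintro s t ⟨C, hC⟩ ⟨C', hC'⟩
      exact ⟨max C C', fun x hx => hx.elim (fun hx => hmono (le_max_left _ _) (hC x hx))
        fun hx => hmono (le_max_right _ _) (hC' x hx)⟩
    · obtain ⟨C, hC⟩ := hloc x
      exact ⟨_, mem_nhdsWithin_of_mem_nhds hC, C, fun y hy => hy⟩
  exact ⟨max C 0, le_max_right _ _, fun x => hmono (le_max_left _ _) (hC x trivial)⟩

end Domination

section SecondOrder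

variable {E F : Type*} [NormedAddCommGroup E] [NormedSpace ℝ E] [NormedAddCommGroup F]
  [NormedSpace ℝ F]

lemma isLittleO_taylor_two {f : E → F} {x : E} (hf : Differentiable ℝ f)
    (hf' : DifferentiableAt ℝ (fderiv ℝ f) x) :
    (fun w => f (x + w) - f x - fderiv ℝ f x w - (2⁻¹ : ℝ) • fderiv ℝ (fderiv ℝ f) x w w)
      =o[𝓝 0] fun w => ‖w‖ ^ 2 := by
  refine Asymptotics.isLittleO_iff.2 fun ε hε => ?_
  set H := fderiv ℝ (fderiv ℝ f) x
  obtain ⟨δ, hδ, hfirst⟩ := Metric.eventually_nhds_iff_ball.1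
    ((hasFDerivAt_iff_isLittleO_nhds_zero.1 hf'.hasFDerivAt).def hε)
  filter_upwards [Metric.ball_mem_nhds 0 hδ] with w hw
  have hderiv : ∀ t ∈ Set.Icc (0 : ℝ) 1, HasDerivWithinAt
      (fun t : ℝ => f (x + t • w) - t • fderiv ℝ f x w - (2⁻¹ * t ^ 2) • H w w)
      ((fderiv ℝ f (x + t • w) - fderiv ℝ f x - H (t • w)) w) (Set.Icc 0 1) t := by
    intro t _
    have hline : HasDerivAt (fun t : ℝ => x + t • w) w t := by
      simpa using ((hasDerivAt_id t).smul_const w).const_add x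
    have hlinear := (hasDerivAt_id t).smul_const (fderiv ℝ f x w)
    have hsq : HasDerivAt (fun t : ℝ => 2⁻¹ * t ^ 2) t t :=
      ((hasDerivAt_pow 2 t).const_mul (2⁻¹ : ℝ)).congr_deriv (by push_cast; ring)
    refine ((((hf _).hasFDerivAt.comp_hasDerivAt t hline).sub hlinear).sub
      (hsq.smul_const (H w w))).hasDerivWithinAt.congr_deriv ?_
    simp
  have hbound : ∀ t ∈ Set.Ico (0 : ℝ) 1,
      ‖(fderiv ℝ f (x + t • w) - fderiv ℝ f x - H (t • w)) w‖ ≤ ε * ‖w‖ ^ 2 := by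
    intro t ht
    have htw : ‖t • w‖ ≤ ‖w‖ := by
      rw [norm_smul, Real.norm_of_nonneg ht.1]
      exact mul_le_of_le_one_left (norm_nonneg _) ht.2.le
    have hball : t • w ∈ Metric.ball 0 δ :=
      mem_ball_zero_iff.2 (htw.trans_lt (mem_ball_zero_iff.1 hw))
    calc _ ≤ ‖fderiv ℝ f (x + t • w) - fderiv ℝ f x - H (t • w)‖ * ‖w‖ :=
          ContinuousLinearMap.le_opNorm _ _
      _ ≤ (ε * ‖w‖) * ‖w‖ := by gcongr; exact (hfirst _ hball).trans (by gcongr)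
      _ = ε * ‖w‖ ^ 2 := by ring
  have hmean := norm_image_sub_le_of_norm_deriv_le_segment_01' hderiv hbound
  rw [norm_pow, norm_norm]
  convert hmean using 2
  simp only [one_smul, zero_smul, add_zero, one_pow, mul_one, zero_pow two_ne_zero, mul_zero,
    sub_zero]
  abel

lemma isCoercive_of_pos [FiniteDimensional ℝ E] {B : E →L[ℝ] E →L[ℝ] ℝ}
    (hB : ∀ v, v ≠ 0 → 0 < B v v) : IsCoercive B := by
  rcases subsingleton_or_nontrivial E with hE | hE
  · exact ⟨1, one_pos, fun v => by simp [Subsingleton.elim v 0]⟩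
  have hcont : Continuous fun v => B v v := B.continuous.clm_apply continuous_id
  obtain ⟨v₀, hv₀, hmin⟩ := (isCompact_sphere (0 : E) 1).exists_isMinOn
    (NormedSpace.sphere_nonempty.2 zero_le_one) hcont.continuousOn
  refine ⟨B v₀ v₀, hB v₀ (ne_zero_of_mem_unit_sphere ⟨v₀, hv₀⟩), fun v => ?_⟩
  rcases eq_or_ne v 0 with rfl | hv
  · simp
  have hnorm : 0 < ‖v‖ := norm_pos_iff.2 hv
  have hunit : B v₀ v₀ ≤ B (‖v‖⁻¹ • v) (‖v‖⁻¹ • v) :=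
    hmin (show ‖v‖⁻¹ • v ∈ Metric.sphere (0 : E) 1 by simp [norm_smul, hnorm.ne'])
  have hscale : B (‖v‖⁻¹ • v) (‖v‖⁻¹ • v) * ‖v‖ * ‖v‖ = B v v := by
    simp only [map_smul, smul_apply, smul_eq_mul]
    field_simp
  rw [← hscale]
  gcongr

end SecondOrder

/-! ### The torus and its covering -/

lemma proj_add (v w : ℝ × ℝ) : proj (v + w) = proj v + proj w := by
  simp [proj]

lemma proj_sub (v w : ℝ × ℝ) : proj (v - w) = proj v - proj w := by
  simp [proj]

lemma proj_surjective : Function.Surjective proj := by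
  rintro ⟨x, y⟩
  obtain ⟨x, rfl⟩ := QuotientAddGroup.mk_surjective x
  obtain ⟨y, rfl⟩ := QuotientAddGroup.mk_surjective y
  exact ⟨(x, y), rfl⟩

lemma isOpenQuotientMap_proj : IsOpenQuotientMap proj :=
  (QuotientAddGroup.isOpenQuotientMap_mk (N := AddSubgroup.zmultiples (1 : ℝ))).prodMap
    (QuotientAddGroup.isOpenQuotientMap_mk (N := AddSubgroup.zmultiples (1 : ℝ)))

lemma continuous_proj : Continuous proj :=
  isOpenQuotientMap_proj.continuous

lemma proj_image_Icc : proj '' Set.Icc 0 1 = Set.univ := by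
  have hcircle : ((↑) : ℝ → UnitAddCircle) '' Set.Icc 0 1 = Set.univ := by
    simpa using AddCircle.coe_image_Icc_eq (1 : ℝ) 0
  rw [show (Set.Icc 0 1 : Set (ℝ × ℝ)) = Set.Icc 0 1 ×ˢ Set.Icc 0 1 from (Set.Icc_prod_Icc ..).symm]
  exact (Set.prodMap_image_prod _ _ _ _).trans (by rw [hcircle, Set.univ_prod_univ])

lemma norm_coe_circle_le (w : ℝ) : ‖(w : UnitAddCircle)‖ ≤ |w| :=
  QuotientAddGroup.norm_mk_le_norm

lemma norm_circle_le_half (y : UnitAddCircle) : ‖y‖ ≤ 1 / 2 := by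
  simpa using AddCircle.norm_le_half_period (1 : ℝ) (x := y) one_ne_zero

lemma norm_proj_eq {w : ℝ × ℝ} (hw : ‖w‖ ≤ 1 / 2) : ‖proj w‖ = ‖w‖ := by
  have hcircle {t : ℝ} (ht : |t| ≤ 1 / 2) : ‖(t : UnitAddCircle)‖ = |t| :=
    (AddCircle.norm_coe_eq_abs_iff 1 one_ne_zero).2 (by simpa using ht)
  rw [Prod.norm_def, Prod.norm_def]
  exact congrArg₂ max (hcircle ((norm_fst_le w).trans hw)) (hcircle ((norm_snd_le w).trans hw))

lemma map_add_proj_nhds_zero (p : Torus2) : map (fun w => p + proj w) (𝓝 0) = 𝓝 p := by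
  have hopen : map proj (𝓝 0) = 𝓝 0 := isOpenQuotientMap_proj.map_nhds_eq 0
  change map ((p + ·) ∘ proj) (𝓝 0) = 𝓝 p
  rw [← Filter.map_map, hopen, map_add_left_nhds_zero]

lemma eventually_nhds_of_lift {p : Torus2} {P : Torus2 → ℝ → Prop}
    (h : ∀ᶠ w in 𝓝 (0 : ℝ × ℝ), P (p + proj w) ‖w‖) : ∀ᶠ x in 𝓝 p, P x ‖x - p‖ := by
  rw [← map_add_proj_nhds_zero p, eventually_map]
  filter_upwards [h, Metric.closedBall_mem_nhds 0 one_half_pos] with w hw hball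
  rwa [add_sub_cancel_left, norm_proj_eq (mem_closedBall_zero_iff.1 hball)]

lemma exists_lipschitzWith_comp_proj {F : Type*} [NormedAddCommGroup F] [NormedSpace ℝ F]
    {f : Torus2 → F} (hf : ContDiff ℝ 1 fun w => f (proj w)) :
    ∃ K, LipschitzWith K fun w => f (proj w) := by
  set g := fun w => f (proj w) with hg
  have hperiodic {v w : ℝ × ℝ} (hvw : proj v = proj w) : fderiv ℝ g v = fderiv ℝ g w := by
    have htranslate : (fun u => g (u + (v - w))) = g := by
      funext u
      simp [hg, proj_add, proj_sub, hvw]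
    calc fderiv ℝ g v = fderiv ℝ (fun u => g (u + (v - w))) w := by
          rw [fderiv_comp_add_right, add_sub_cancel]
      _ = fderiv ℝ g w := by rw [htranslate]
  obtain ⟨M, hM⟩ := (isCompact_Icc (a := (0 : ℝ × ℝ)) (b := 1)).bddAbove_image
    (f := fun w => ‖fderiv ℝ g w‖₊) (hf.continuous_fderiv one_ne_zero).nnnorm.continuousOn
  refine ⟨M, lipschitzWith_of_nnnorm_fderiv_le (hf.differentiable one_ne_zero) fun w => ?_⟩
  obtain ⟨v, hv, hvw⟩ : proj w ∈ proj '' Set.Icc 0 1 := proj_image_Icc ▸ Set.mem_univ _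
  rw [← hperiodic hvw]
  exact hM ⟨v, hv, rfl⟩

/-! ### Stopping functions -/

section StoppingFunction

variable {φ : Torus2 → ℝ} {p q : Torus2}

lemma IsStoppingFunction.symm (h : IsStoppingFunction φ p q) : IsStoppingFunction φ q p :=
  ⟨h.contDiff, h.nonneg, h.ne.symm, fun x => (h.eq_zero_iff x).trans or_comm, h.hessian_right,
    h.hessian_left⟩

lemma IsStoppingFunction.continuous (h : IsStoppingFunction φ p q) : Continuous φ :=
  isOpenQuotientMap_proj.isQuotientMap.continuous_iff.2 h.contDiff.continuous

lemma IsStoppingFunction.left_eq_zero (h : IsStoppingFunction φ p q) : φ p = 0 :=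
  (h.eq_zero_iff p).2 (Or.inl rfl)

lemma IsStoppingFunction.exists_le (h : IsStoppingFunction φ p q) :
    ∃ M : ℝ, 0 < M ∧ ∀ x, φ x ≤ M := by
  obtain ⟨M, hM⟩ := isCompact_univ.bddAbove_image h.continuous.continuousOn
  exact ⟨max M 1, by positivity, fun x => (hM ⟨x, trivial, rfl⟩).trans (le_max_left _ _)⟩

lemma IsStoppingFunction.isLittleO_taylor (h : IsStoppingFunction φ p q) {P : ℝ × ℝ}
    (hP : proj P = p) :
    (fun w => φ (p + proj w) - 2⁻¹ * fderiv ℝ (fderiv ℝ fun w : ℝ × ℝ => φ (proj w)) P w w)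
      =o[𝓝 0] fun w => ‖w‖ ^ 2 := by
  have hcritical : fderiv ℝ (fun w : ℝ × ℝ => φ (proj w)) P = 0 :=
    IsLocalMin.fderiv_eq_zero (Eventually.of_forall fun w => by
      simpa only [hP, h.left_eq_zero] using h.nonneg (proj w))
  have htaylor := isLittleO_taylor_two (x := P) (h.contDiff.differentiable (by norm_num))
    ((h.contDiff.fderiv_right (m := 1) (by norm_num)).differentiable (by norm_num) P)
  simpa [h.left_eq_zero, hcritical, proj_add, hP] using htaylor

lemma IsStoppingFunction.exists_le_mul_sq (h : IsStoppingFunction φ p q) :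
    ∃ C, 0 ≤ C ∧ ∀ x, φ x ≤ C * ‖x - p‖ ^ 2 := by
  refine exists_forall_le_mul h.continuous (by fun_prop) (fun x => by positivity) fun x hx => ?_
  obtain rfl : x = p := by simpa [sub_eq_zero] using hx
  obtain ⟨P, hP⟩ := proj_surjective x
  set H := fderiv ℝ (fderiv ℝ fun w : ℝ × ℝ => φ (proj w)) P
  refine ⟨2⁻¹ * ‖H‖ + 1, eventually_nhds_of_lift (P := fun y r => φ y ≤ _ * r ^ 2) ?_⟩
  filter_upwards [(h.isLittleO_taylor hP).def one_pos] with w hw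
  have hH : H w w ≤ ‖H‖ * ‖w‖ * ‖w‖ := (le_abs_self _).trans (H.le_opNorm₂ w w)
  have hexpand := (abs_le.1 hw).2
  rw [norm_pow, norm_norm] at hexpand
  linarith

lemma IsStoppingFunction.exists_mul_sq_le (h : IsStoppingFunction φ p q) :
    ∃ c > 0, ∀ᶠ x in 𝓝 p, c * ‖x - p‖ ^ 2 ≤ φ x := by
  obtain ⟨P, hP⟩ := proj_surjective p
  obtain ⟨c, hc, hcoercive⟩ := isCoercive_of_pos (h.hessian_left P hP)
  refine ⟨c / 4, by positivity, eventually_nhds_of_lift (P := fun y r => c / 4 * r ^ 2 ≤ φ y) ?_⟩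
  filter_upwards [(h.isLittleO_taylor hP).def (show 0 < c / 4 by positivity)] with w hw
  have hexpand := (abs_le.1 hw).1
  rw [norm_pow, norm_norm] at hexpand
  linarith [hcoercive w]

lemma IsStoppingFunction.exists_abs_le (h : IsStoppingFunction φ p q) (f : C(Torus2, ℝ))
    (hp : f p = 0) (hq : f q = 0) {ε : ℝ} (hε : 0 < ε) :
    ∃ C, 0 ≤ C ∧ ∀ x, |f x| ≤ ε + C * φ x := by
  obtain ⟨C, hC, hle⟩ := exists_forall_le_mul (f := fun x => |f x| - ε)
    (by fun_prop) h.continuous h.nonneg fun x hx => by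
      have hfx : |f x| < ε := by rcases (h.eq_zero_iff x).1 hx with rfl | rfl <;> simp [hp, hq, hε]
      refine ⟨0, ?_⟩
      filter_upwards [f.continuous.abs.continuousAt.eventually_lt_const hfx] with y hy
      linarith
  exact ⟨C, hC, fun x => by linarith [hle x]⟩

lemma IsStoppingFunction.exists_abs_mul_sq_le (h : IsStoppingFunction φ p q) (g : C(Torus2, ℝ))
    (hp : g p = 0) {ε : ℝ} (hε : 0 < ε) :
    ∃ C, 0 ≤ C ∧ ∀ x, |g x| * ‖x - q‖ ^ 2 ≤ ε * ‖x - q‖ ^ 2 + C * φ x := by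
  obtain ⟨c, hc, hquad⟩ := h.symm.exists_mul_sq_le
  obtain ⟨C, hC, hle⟩ := exists_forall_le_mul (f := fun x => (|g x| - ε) * ‖x - q‖ ^ 2)
    (by fun_prop) h.continuous h.nonneg fun x hx => by
      rcases (h.eq_zero_iff x).1 hx with rfl | rfl
      · have hgx : |g x| < ε := by simpa [hp]
        refine ⟨0, ?_⟩
        filter_upwards [g.continuous.abs.continuousAt.eventually_lt_const hgx] with y hy
        rw [zero_mul]
        exact mul_nonpos_of_nonpos_of_nonneg (by linarith) (by positivity)
      · refine ⟨‖g‖ / c, ?_⟩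
        filter_upwards [hquad] with y hy
        calc (|g y| - ε) * ‖y - x‖ ^ 2 ≤ ‖g‖ * ‖y - x‖ ^ 2 := by
              gcongr
              linarith [g.norm_coe_le_norm y, Real.norm_eq_abs (g y)]
          _ = ‖g‖ / c * (c * ‖y - x‖ ^ 2) := by field_simp
          _ ≤ ‖g‖ / c * φ y := by gcongr
  exact ⟨C, hC, fun x => by linarith [hle x]⟩

end StoppingFunction

/-! ### Flows of bounded Lipschitz vector fields -/

section GlobalFlow

open scoped NNReal

variable {E : Type*} [NormedAddCommGroup E] {V : E → E} {K M : ℝ≥0}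

lemma isPicardLindelof_of_bounded (hK : LipschitzWith K V) (hM : ∀ x, ‖V x‖ ≤ M) (x₀ : E)
    (r T : ℝ≥0) :
    IsPicardLindelof (fun _ => V) (tmin := -(T : ℝ)) (tmax := T) ⟨0, by simp⟩ x₀
      (M * T + r) r M K :=
  IsPicardLindelof.of_time_independent (fun x _ => hM x) hK.lipschitzOnWith (by simp)

variable [NormedSpace ℝ E]

lemma eqOn_Icc_of_hasDerivWithinAt (hK : LipschitzWith K V) {f g : ℝ → E} {T : ℝ} (hT : 0 < T)
    (hf : ∀ t ∈ Set.Icc (-T) T, HasDerivWithinAt f (V (f t)) (Set.Icc (-T) T) t)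
    (hg : ∀ t ∈ Set.Icc (-T) T, HasDerivWithinAt g (V (g t)) (Set.Icc (-T) T) t)
    (h0 : f 0 = g 0) : Set.EqOn f g (Set.Icc (-T) T) :=
  ODE_solution_unique_of_mem_Icc (v := fun _ => V) (s := fun _ => Set.univ) (t₀ := 0)
    (fun _ _ => hK.lipschitzOnWith) ⟨by linarith, hT⟩
    (fun t ht => (hf t ht).continuousWithinAt)
    (fun t ht => (hf t (Set.Ioo_subset_Icc_self ht)).hasDerivAt (Icc_mem_nhds ht.1 ht.2))
    (fun _ _ => trivial)
    (fun t ht => (hg t ht).continuousWithinAt)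
    (fun t ht => (hg t (Set.Ioo_subset_Icc_self ht)).hasDerivAt (Icc_mem_nhds ht.1 ht.2))
    (fun _ _ => trivial) h0

lemma eq_of_hasDerivAt (hK : LipschitzWith K V) {f g : ℝ → E}
    (hf : ∀ t, HasDerivAt f (V (f t)) t) (hg : ∀ t, HasDerivAt g (V (g t)) t)
    (h0 : f 0 = g 0) : f = g :=
  ODE_solution_unique_univ (v := fun _ => V) (s := fun _ => Set.univ) (t₀ := 0)
    (fun _ => hK.lipschitzOnWith) (fun t => ⟨hf t, trivial⟩) (fun t => ⟨hg t, trivial⟩) h0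

variable [CompleteSpace E]

lemma exists_forall_hasDerivAt (hK : LipschitzWith K V) (hM : ∀ x, ‖V x‖ ≤ M) (x : E) :
    ∃ γ : ℝ → E, γ 0 = x ∧ ∀ t, HasDerivAt γ (V (γ t)) t := by
  choose α hα0 hα using fun T : ℝ≥0 =>
    (isPicardLindelof_of_bounded hK hM x 0 T).exists_eq_forall_mem_Icc_hasDerivWithinAt₀
  have hagree : ∀ {S T : ℝ≥0}, 0 < S → S ≤ T → Set.EqOn (α S) (α T) (Set.Icc (-(S : ℝ)) S) :=
    fun {S T} hS hST =>
      have hsub : Set.Icc (-(S : ℝ)) S ⊆ Set.Icc (-(T : ℝ)) T :=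
        Set.Icc_subset_Icc (neg_le_neg (NNReal.coe_le_coe.2 hST)) (NNReal.coe_le_coe.2 hST)
      eqOn_Icc_of_hasDerivWithinAt hK (NNReal.coe_pos.2 hS) (hα S)
        (fun t ht => (hα T t (hsub ht)).mono hsub) (by rw [hα0, hα0])
  have hmem (t : ℝ) : t ∈ Set.Ioo (-((‖t‖₊ + 1 : ℝ≥0) : ℝ)) (‖t‖₊ + 1 : ℝ≥0) := by
    rw [Set.mem_Ioo, ← abs_lt]
    simp
  have hγ {T : ℝ≥0} (hT : 0 < T) {t : ℝ} (ht : t ∈ Set.Icc (-(T : ℝ)) T) :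
      α (‖t‖₊ + 1) t = α T t := by
    rcases le_total (‖t‖₊ + 1) T with h | h
    · exact hagree (by positivity) h (Set.Ioo_subset_Icc_self (hmem t))
    · exact (hagree hT h ht).symm
  refine ⟨fun t => α (‖t‖₊ + 1) t, hα0 _, fun t => ?_⟩
  have hnhds := Icc_mem_nhds (hmem t).1 (hmem t).2
  refine ((hα _ t (Set.Ioo_subset_Icc_self (hmem t))).hasDerivAt hnhds).congr_of_eventuallyEq ?_
  filter_upwards [hnhds] with s hs
  exact hγ (by positivity) hs

lemma continuous_solution (hK : LipschitzWith K V) (hM : ∀ x, ‖V x‖ ≤ M) {Φ : E → ℝ → E}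
    (hΦ0 : ∀ x, Φ x 0 = x) (hΦ : ∀ x t, HasDerivAt (Φ x) (V (Φ x t)) t) :
    Continuous fun z : E × ℝ => Φ z.1 z.2 := by
  refine continuous_iff_continuousAt.2 fun ⟨x, t⟩ => ?_
  set T : ℝ≥0 := ‖t‖₊ + 1
  have ht : |t| < T := by simp [T]
  obtain ⟨α, hα, hαc⟩ := (isPicardLindelof_of_bounded hK hM x 1
    T).exists_forall_mem_closedBall_eq_hasDerivWithinAt_continuousOn
  have heq : Set.EqOn (fun z : E × ℝ => Φ z.1 z.2) α
      (Metric.closedBall x (1 : ℝ≥0) ×ˢ Set.Icc (-(T : ℝ)) T) := by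
    rintro ⟨y, s⟩ ⟨hy, hs⟩
    exact eqOn_Icc_of_hasDerivWithinAt hK ((abs_nonneg t).trans_lt ht)
      (fun t _ => (hΦ y t).hasDerivWithinAt) (hα y hy).2 ((hΦ0 y).trans (hα y hy).1.symm) hs
  exact (hαc.congr heq).continuousAt (prod_mem_nhds (Metric.closedBall_mem_nhds x one_pos)
    (Icc_mem_nhds (abs_lt.1 ht).1 (abs_lt.1 ht).2))

theorem exists_flow_hasDerivAt (hK : LipschitzWith K V) (hM : ∀ x, ‖V x‖ ≤ M) :
    ∃ Φ : Flow ℝ E, ∀ x t, HasDerivAt (fun s => Φ s x) (V (Φ t x)) t := by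
  choose Φ hΦ0 hΦ using exists_forall_hasDerivAt hK hM
  refine ⟨⟨fun t x => Φ x t, (continuous_solution hK hM hΦ0 hΦ).comp continuous_swap,
    fun s t x => ?_, hΦ0⟩, hΦ⟩
  have hshift : (fun s => Φ x (s + t)) = Φ (Φ x t) :=
    eq_of_hasDerivAt hK (fun s => (hΦ x (s + t)).comp_add_const s t) (hΦ _) (by simp [hΦ0])
  exact congrFun hshift s

end GlobalFlow

lemma exists_flow_isSemiconjugacy {τ X Y : Type*} [TopologicalSpace τ] [AddMonoid τ]
    [TopologicalSpace X] [TopologicalSpace Y] {π : X → Y}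
    (hπ : IsOpenQuotientMap π) (Φ : Flow τ X)
    (hΦ : ∀ t x y, π x = π y → π (Φ t x) = π (Φ t y)) :
    ∃ T : Flow τ Y, Flow.IsSemiconjugacy π Φ T := by
  choose ℓ hℓ using hπ.surjective
  have hlift (t : τ) (x : X) : π (Φ t (ℓ (π x))) = π (Φ t x) := hΦ t _ _ (hℓ _)
  refine ⟨⟨fun t y => π (Φ t (ℓ y)), ?_, fun s t y => ?_, fun y => ?_⟩, hπ.continuous,
    hπ.surjective, fun t x => (hlift t x).symm⟩
  · refine (IsOpenQuotientMap.id.prodMap hπ).isQuotientMap.continuous_iff.2 ?_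
    exact (hπ.continuous.comp Φ.cont').congr fun z => (hlift z.1 z.2).symm
  · rw [hlift, Φ.map_add]
  · rw [Φ.map_zero_apply, hℓ]

section Orbits

variable {φ : Torus2 → ℝ} {p q : Torus2} {T : Flow ℝ Torus2} {a : ℝ}

lemma IsStoppingFunction.exists_lipschitzWith_field (h : IsStoppingFunction φ p q) (v : ℝ × ℝ) :
    ∃ K, LipschitzWith K fun w : ℝ × ℝ => φ (proj w) • v := by
  obtain ⟨K, hK⟩ := exists_lipschitzWith_comp_proj (h.contDiff.of_le (by norm_num))
  exact ⟨_, ((ContinuousLinearMap.id ℝ ℝ).smulRight v).lipschitz.comp hK⟩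

lemma IsStoppingFunction.exists_isGeneratedBy (h : IsStoppingFunction φ p q) (a : ℝ) :
    ∃ T : Flow ℝ Torus2, IsGeneratedBy T φ a := by
  obtain ⟨K, hK⟩ := h.exists_lipschitzWith_field (1, a)
  obtain ⟨M, hM, hle⟩ := h.exists_le
  have hbound (w : ℝ × ℝ) : ‖φ (proj w) • ((1 : ℝ), a)‖ ≤ (M * ‖((1 : ℝ), a)‖).toNNReal := by
    rw [Real.coe_toNNReal _ (by positivity), norm_smul, Real.norm_of_nonneg (h.nonneg _)]
    gcongr
    exact hle _
  obtain ⟨Φ, hΦ⟩ := exists_flow_hasDerivAt hK hbound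
  have hperiodic (t : ℝ) (v w : ℝ × ℝ) (hvw : proj v = proj w) : proj (Φ t v) = proj (Φ t w) := by
    have htranslate : (fun t => Φ t v) = fun t => Φ t w + (v - w) := by
      refine eq_of_hasDerivAt hK (hΦ v) (fun t => ?_) (by simp)
      simpa [proj_add, proj_sub, hvw] using (hΦ w t).add_const (v - w)
    simp [congrFun htranslate t, proj_add, proj_sub, hvw]
  obtain ⟨T, hT⟩ := exists_flow_isSemiconjugacy isOpenQuotientMap_proj Φ hperiodic
  refine ⟨T, fun x => ?_⟩
  obtain ⟨v, rfl⟩ := proj_surjective x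
  exact ⟨fun t => Φ t v, fun t => (hT.semiconj t v).symm, hΦ v⟩

/-- The one-parameter subgroup of the torus with direction `(1, a)`. -/
def line (a σ : ℝ) : Torus2 := proj (σ, a * σ)

lemma line_add (a σ τ : ℝ) : line a (σ + τ) = line a σ + line a τ := by
  simp [line, proj, mul_add]

lemma continuous_line (a : ℝ) : Continuous (line a) :=
  continuous_proj.comp (by fun_prop)

/-- `θ` is the arc parameter of the orbit of `x` under `φ • (1, a)`: at time `t` the orbit is at
`x + line a (θ t)`. -/
structure IsParam (φ : Torus2 → ℝ) (a : ℝ) (x : Torus2) (θ : ℝ → ℝ) : Prop where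
  map_zero : θ 0 = 0
  hasDerivAt : ∀ t, HasDerivAt θ (φ (x + line a (θ t))) t

lemma IsGeneratedBy.exists_isParam (hT : IsGeneratedBy T φ a) (x : Torus2) :
    ∃ θ : ℝ → ℝ, IsParam φ a x θ ∧ ∀ t, T t x = x + line a (θ t) := by
  obtain ⟨γ, hγ, hγ'⟩ := hT x
  have hfst (t : ℝ) : HasDerivAt (fun t => (γ t).1) (φ (proj (γ t))) t :=
    (hasFDerivAt_fst.comp_hasDerivAt t (hγ' t)).congr_deriv (by simp)
  have hsnd (t : ℝ) : HasDerivAt (fun t => (γ t).2) (φ (proj (γ t)) * a) t :=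
    (hasFDerivAt_snd.comp_hasDerivAt t (hγ' t)).congr_deriv (by simp)
  have hdiff (t : ℝ) : HasDerivAt (fun t => (γ t).2 - a * (γ t).1) 0 t :=
    ((hsnd t).sub ((hfst t).const_mul a)).congr_deriv (by ring)
  have hinvariant (t : ℝ) : (γ t).2 - a * (γ t).1 = (γ 0).2 - a * (γ 0).1 :=
    is_const_of_deriv_eq_zero (fun t => (hdiff t).differentiableAt) (fun t => (hdiff t).deriv) t 0
  have hx : proj (γ 0) = x := by rw [← hγ, T.map_zero_apply]
  have horbit (t : ℝ) : proj (γ t) = x + line a ((γ t).1 - (γ 0).1) := by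
    rw [← hx, line, ← proj_add]
    congr 1
    exact Prod.ext (by simp) (by simp only [Prod.snd_add]; linarith [hinvariant t])
  refine ⟨fun t => (γ t).1 - (γ 0).1, ⟨sub_self _, fun t => ?_⟩, fun t => (hγ t).trans (horbit t)⟩
  rw [← horbit]
  exact (hfst t).sub_const _

lemma IsStoppingFunction.flow_left_eq (h : IsStoppingFunction φ p q) (hT : IsGeneratedBy T φ a)
    (t : ℝ) : T t p = p := by
  obtain ⟨K, hK⟩ := h.exists_lipschitzWith_field (1, a)
  obtain ⟨γ, hγ, hγ'⟩ := hT p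
  have hp : proj (γ 0) = p := by rw [← hγ, T.map_zero_apply]
  have hconst : γ = fun _ => γ 0 := by
    refine eq_of_hasDerivAt hK hγ' (fun t => ?_) rfl
    rw [hp, h.left_eq_zero, zero_smul]
    exact hasDerivAt_const t _
  rw [hγ, hconst, hp]

end Orbits

/-! ### Equidistribution of lines -/

section WeakConvergence

variable {X ι : Type*} [TopologicalSpace X] [MeasurableSpace X]

lemma integrable_of_continuous [CompactSpace X] [OpensMeasurableSpace X] {E : Type*}
    [NormedAddCommGroup E] {μ : Measure X} [IsFiniteMeasure μ]
    {f : X → E} (hf : Continuous f) : Integrable f μ :=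
  hf.integrable_of_hasCompactSupport (.of_compactSpace f)

lemma dist_integral_le_of_measure_univ_le_one [CompactSpace X] [OpensMeasurableSpace X]
    {μ : Measure X} (hμ : μ Set.univ ≤ 1) (f g : C(X, ℂ)) :
    dist (∫ y, f y ∂μ) (∫ y, g y ∂μ) ≤ dist f g := by
  have : IsFiniteMeasure μ := ⟨hμ.trans_lt ENNReal.one_lt_top⟩
  rw [dist_eq_norm, ← integral_sub (integrable_of_continuous f.continuous)
    (integrable_of_continuous g.continuous)]
  calc ‖∫ y, (f y - g y) ∂μ‖ ≤ dist f g * μ.real Set.univ :=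
        norm_integral_le_of_norm_le_const (Eventually.of_forall fun y => by
          rw [← dist_eq_norm]
          exact ContinuousMap.dist_apply_le_dist y)
    _ ≤ dist f g := mul_le_of_le_one_right dist_nonneg (ENNReal.toReal_mono ENNReal.one_ne_top hμ)

lemma tendsto_integral_of_topologicalClosure_span_eq_top [CompactSpace X] [OpensMeasurableSpace X]
    {l : Filter ι} {μ : ι → Measure X} {ν : Measure X} (hμ : ∀ i, μ i Set.univ ≤ 1)
    (hν : ν Set.univ ≤ 1) {S : Set C(X, ℂ)} (hS : (Submodule.span ℂ S).topologicalClosure = ⊤)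
    (h : ∀ f ∈ S, Tendsto (fun i => ∫ y, f y ∂μ i) l (𝓝 (∫ y, f y ∂ν))) (f : C(X, ℂ)) :
    Tendsto (fun i => ∫ y, f y ∂μ i) l (𝓝 (∫ y, f y ∂ν)) := by
  have hfin {m : Measure X} (hm : m Set.univ ≤ 1) : IsFiniteMeasure m :=
    ⟨hm.trans_lt ENNReal.one_lt_top⟩
  have hint {m : Measure X} (hm : m Set.univ ≤ 1) (f : C(X, ℂ)) : Integrable f m :=
    have := hfin hm
    integrable_of_continuous f.continuous
  have hlip {m : Measure X} (hm : m Set.univ ≤ 1) :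
      LipschitzWith 1 fun f : C(X, ℂ) => ∫ y, f y ∂m :=
    LipschitzWith.mk_one (dist_integral_le_of_measure_univ_le_one hm)
  have hclosed : IsClosed {f : C(X, ℂ) | Tendsto (fun i => ∫ y, f y ∂μ i) l (𝓝 (∫ y, f y ∂ν))} :=
    (LipschitzWith.uniformEquicontinuous _ 1 fun i =>
      hlip (hμ i)).equicontinuous.isClosed_setOfPred_tendsto (hlip hν).continuous
  have hspan : (Submodule.span ℂ S : Set C(X, ℂ)) ⊆
      {f | Tendsto (fun i => ∫ y, f y ∂μ i) l (𝓝 (∫ y, f y ∂ν))} := by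
    intro f hf
    induction hf using Submodule.span_induction with
    | mem f hf => exact h f hf
    | zero => simp [tendsto_const_nhds]
    | add f g _ _ hf hg =>
      simpa [integral_add (hint (hμ _) f) (hint (hμ _) g),
        integral_add (hint hν f) (hint hν g)] using Tendsto.add hf hg
    | smul c f _ hf => simpa [integral_const_mul] using Tendsto.const_mul c hf
  have hdense := hclosed.closure_subset_iff.2 hspan
  rw [← Submodule.topologicalClosure_coe, hS] at hdense
  exact hdense trivial

/-- The normalized occupation measure over `[0, s]` of the curve `γ`; it is `0` for `s ≤ 0`. -/
def occupation (γ : ℝ → X) (s : ℝ) : Measure X :=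
  (ENNReal.ofReal s)⁻¹ • (volume.restrict (Set.Ioc 0 s)).map γ

lemma occupation_univ_le_one [BorelSpace X] {γ : ℝ → X} (hγ : Continuous γ) (s : ℝ) :
    occupation γ s Set.univ ≤ 1 := by
  simp [occupation, Measure.map_apply hγ.measurable .univ, ENNReal.inv_mul_le_one]

lemma integral_occupation [BorelSpace X] {E : Type*} [NormedAddCommGroup E] [NormedSpace ℝ E]
    [SecondCountableTopology E] {γ : ℝ → X} (hγ : Continuous γ) {s : ℝ} (hs : 0 < s) {f : X → E}
    (hf : Continuous f) :
    ∫ y, f y ∂occupation γ s = s⁻¹ • ∫ σ in (0 : ℝ)..s, f (γ σ) := by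
  borelize E
  rw [occupation, integral_smul_measure, integral_map hγ.aemeasurable
    hf.aestronglyMeasurable, intervalIntegral.integral_of_le hs.le, ENNReal.toReal_inv,
    ENNReal.toReal_ofReal hs.le]

end WeakConvergence

section Weyl

open UnitAddTorus

instance : IsProbabilityMeasure (volume : Measure UnitAddCircle) :=
  ⟨UnitAddCircle.measure_univ⟩

instance : Measure.IsAddHaarMeasure (volume : Measure Torus2) :=
  inferInstanceAs (Measure.IsAddHaarMeasure
    ((volume : Measure UnitAddCircle).prod (volume : Measure UnitAddCircle)))

variable {d : Type*} [Fintype d]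

lemma mFourier_add_coe (n : d → ℤ) (x : UnitAddTorus d) (v : d → ℝ) :
    mFourier n (x + fun i => (v i : UnitAddCircle)) =
      mFourier n x * Complex.exp ((2 * Real.pi * ∑ i, n i * v i : ℝ) * Complex.I) := by
  have hfourier (k : ℤ) (y z : UnitAddCircle) :
      fourier k (y + z) = fourier k y * fourier k z := by
    simp [fourier_apply, smul_add, AddCircle.toCircle_add]
  simp only [mFourier, ContinuousMap.coe_mk, Pi.add_apply, hfourier, Finset.prod_mul_distrib,
    fourier_coe_apply, ← Complex.exp_sum]
  congr 2
  push_cast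
  rw [Finset.mul_sum, Finset.sum_mul]
  exact Finset.sum_congr rfl fun i _ => by ring

lemma integral_mFourier_eq_zero {n : d → ℤ} (hn : n ≠ 0) : ∫ x, mFourier n x = 0 := by
  classical
  obtain ⟨j, hj⟩ := Function.ne_iff.1 hn
  have hj' : (n j : ℝ) ≠ 0 := Int.cast_ne_zero.2 hj
  set v : d → ℝ := Pi.single j (2 * n j : ℝ)⁻¹ with hv
  have hphase : 2 * Real.pi * ∑ i, n i * v i = Real.pi := by
    simp only [hv, Pi.single_apply, mul_ite, mul_zero, Finset.sum_ite_eq', Finset.mem_univ, if_true]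
    field_simp
  have hshift (x : UnitAddTorus d) :
      mFourier n (x + fun i => (v i : UnitAddCircle)) = -mFourier n x := by
    rw [mFourier_add_coe, hphase, Complex.exp_pi_mul_I, mul_neg_one]
  refine self_eq_neg.1 ?_
  calc ∫ x, mFourier n x = ∫ x, mFourier n (x + fun i => (v i : UnitAddCircle)) :=
        (integral_add_right_eq_self (μ := (volume : Measure (UnitAddTorus d))) _ _).symm
    _ = -∫ x, mFourier n x := by simp_rw [hshift, integral_neg]

lemma tendsto_average_exp {κ : ℝ} (hκ : κ ≠ 0) :
    Tendsto (fun s : ℝ => s⁻¹ • ∫ σ in (0 : ℝ)..s, Complex.exp ((κ * σ : ℝ) * Complex.I))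
      atTop (𝓝 0) := by
  have hκI : (κ : ℂ) * Complex.I ≠ 0 := mul_ne_zero (by exact_mod_cast hκ) Complex.I_ne_zero
  have hexp (σ : ℝ) : Complex.exp ((κ * σ : ℝ) * Complex.I) = Complex.exp (κ * Complex.I * σ) := by
    push_cast
    ring_nf
  refine tendsto_inv_atTop_zero.zero_smul_isBoundedUnder_le
    (isBoundedUnder_of ⟨2 / ‖(κ : ℂ) * Complex.I‖, fun s => ?_⟩)
  simp only [hexp, Function.comp_apply, integral_exp_mul_complex hκI, norm_div]
  gcongr
  refine (norm_sub_le _ _).trans_eq ?_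
  rw [← hexp, ← hexp, Complex.norm_exp_ofReal_mul_I, Complex.norm_exp_ofReal_mul_I]
  norm_num

theorem tendsto_average_add_smul {ω : d → ℝ} (hω : ∀ n : d → ℤ, n ≠ 0 → ∑ i, n i * ω i ≠ 0)
    (x : UnitAddTorus d) (G : C(UnitAddTorus d, ℂ)) :
    Tendsto (fun s : ℝ => s⁻¹ • ∫ σ in (0 : ℝ)..s,
      G (x + fun i => ((σ • ω) i : UnitAddCircle))) atTop (𝓝 (∫ y, G y)) := by
  set γ : ℝ → UnitAddTorus d := fun σ => x + fun i => ((σ • ω) i : UnitAddCircle)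
  have hγ : Continuous γ := by fun_prop
  have heq (G : C(UnitAddTorus d, ℂ)) : (fun s => ∫ y, G y ∂occupation γ s) =ᶠ[atTop]
      fun s => s⁻¹ • ∫ σ in (0 : ℝ)..s, G (γ σ) := by
    filter_upwards [eventually_gt_atTop 0] with s hs
    exact integral_occupation hγ hs G.continuous
  refine (tendsto_integral_of_topologicalClosure_span_eq_top (occupation_univ_le_one hγ)
    (by simp) span_mFourier_closure_eq_top ?_ G).congr' (heq G)
  rintro _ ⟨n, rfl⟩
  refine Tendsto.congr' (heq _).symm ?_
  rcases eq_or_ne n 0 with rfl | hn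
  · refine tendsto_const_nhds.congr' ?_
    filter_upwards [eventually_gt_atTop 0] with s hs
    simp [mFourier_zero, hs.ne']
  have hphase (σ : ℝ) : mFourier n (γ σ) = mFourier n x *
      Complex.exp ((2 * Real.pi * (∑ i, n i * ω i) * σ : ℝ) * Complex.I) := by
    rw [mFourier_add_coe, mul_assoc (2 * Real.pi), Finset.sum_mul]
    congr! 5
    exact Finset.sum_congr rfl fun i _ => by rw [Pi.smul_apply, smul_eq_mul]; ring
  have hlim := (tendsto_average_exp (mul_ne_zero Real.two_pi_pos.ne' (hω n hn))).const_mul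
    (mFourier n x)
  simpa only [integral_mFourier_eq_zero hn, hphase, intervalIntegral.integral_const_mul, mul_zero,
    mul_smul_comm] using hlim

end Weyl

lemma sum_int_mul_ne_zero_of_irrational {a : ℝ} (ha : Irrational a) {n : Fin 2 → ℤ}
    (hn : n ≠ 0) : ∑ i, n i * (![1, a] : Fin 2 → ℝ) i ≠ 0 := by
  intro h
  simp only [Fin.sum_univ_two, Matrix.cons_val_zero, Matrix.cons_val_one, mul_one] at h
  have h1 : n 1 = 0 := by
    by_contra h1
    exact ((ha.intCast_mul h1).intCast_add (n 0)).ne_zero h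
  have h0 : n 0 = 0 := by simpa [h1] using h
  exact hn (funext (Fin.forall_fin_two.2 ⟨h0, h1⟩))

lemma tendsto_average_line {a : ℝ} (ha : Irrational a) (x : Torus2) (G : C(Torus2, ℝ)) :
    Tendsto (fun s : ℝ => s⁻¹ * ∫ σ in (0 : ℝ)..s, G (x + line a σ)) atTop (𝓝 (∫ y, G y)) := by
  set e : UnitAddTorus (Fin 2) ≃ₜ Torus2 := Homeomorph.piFinTwo fun _ => UnitAddCircle
  have hmean : ∫ z, (G (e z) : ℂ) = ((∫ y, G y : ℝ) : ℂ) := by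
    rw [← integral_complex_ofReal]
    exact (volume_preserving_piFinTwo fun _ => UnitAddCircle).integral_comp'
      (g := fun y => (G y : ℂ))
  have hline (σ : ℝ) : e (e.symm x + fun i => ((σ • ![1, a] : Fin 2 → ℝ) i : UnitAddCircle)) =
      x + line a σ := by
    ext <;> simp [e, line, proj, mul_comm a, Matrix.vecHead, Matrix.vecTail]
  have hlim := tendsto_average_add_smul (fun n => sum_int_mul_ne_zero_of_irrational ha)
    (e.symm x) ⟨fun z => (G (e z) : ℂ), by fun_prop⟩
  simp only [ContinuousMap.coe_mk, hline, hmean, intervalIntegral.integral_ofReal] at hlim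
  exact (tendsto_ofReal_iff (f := fun s => s⁻¹ * _)).1 (by simpa using hlim)

/-! ### Sublinear speed and empirical measures -/

section Divergence

open scoped ENNReal

variable {X : Type*} [MeasurableSpace X] {μ : Measure X}

lemma exists_le_integral_inv_add [IsFiniteMeasure μ] {f : X → ℝ} (hf : Measurable f)
    (hf0 : ∀ x, 0 ≤ f x) (htop : ∫⁻ x, (ENNReal.ofReal (f x))⁻¹ ∂μ = ∞) (B : ℝ) :
    ∃ η > 0, B ≤ ∫ x, (f x + η)⁻¹ ∂μ := by
  have hη (n : ℕ) : (0 : ℝ) < 1 / (n + 1) := Nat.one_div_pos_of_nat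
  have hlim : Tendsto (fun n : ℕ => ∫⁻ x, (ENNReal.ofReal (f x + 1 / (n + 1)))⁻¹ ∂μ) atTop
      (𝓝 ∞) := by
    rw [← htop]
    refine lintegral_tendsto_of_tendsto_of_monotone (fun n => by fun_prop)
      (Eventually.of_forall fun x m n hmn => ?_) (Eventually.of_forall fun x => ?_)
    · exact ENNReal.inv_le_inv.2 (ENNReal.ofReal_le_ofReal
        (add_le_add_right (Nat.one_div_le_one_div hmn) _))
    · refine ((ENNReal.continuous_ofReal.tendsto _).comp ?_).inv
      simpa using tendsto_one_div_add_atTop_nhds_zero_nat.const_add (f x)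
  obtain ⟨n, hn⟩ := (hlim.eventually_const_le (ENNReal.ofReal_lt_top (r := B))).exists
  have hpos (x : X) : 0 < f x + 1 / (n + 1) := add_pos_of_nonneg_of_pos (hf0 x) (hη n)
  have hint : Integrable (fun x => (f x + 1 / (n + 1))⁻¹) μ := by
    refine .of_bound (C := (1 / (n + 1) : ℝ)⁻¹) (by fun_prop) (Eventually.of_forall fun x => ?_)
    rw [Real.norm_of_nonneg (inv_nonneg.2 (hpos x).le)]
    exact inv_anti₀ (hη n) (le_add_of_nonneg_left (hf0 x))
  refine ⟨_, hη n, (ENNReal.ofReal_le_ofReal_iff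
    (integral_nonneg fun x => inv_nonneg.2 (hpos x).le)).1 ?_⟩
  rw [ofReal_integral_eq_lintegral_ofReal hint
    (Eventually.of_forall fun x => inv_nonneg.2 (hpos x).le)]
  simpa only [ENNReal.ofReal_inv_of_pos (hpos _)] using hn

lemma volume_closedBall_torus (x : Torus2) {r : ℝ} (hr : r ≤ 1 / 2) :
    volume (Metric.closedBall x r) = ENNReal.ofReal (2 * r) ^ 2 := by
  rw [← closedBall_prod_same, Measure.volume_eq_prod, Measure.prod_prod,
    AddCircle.volume_closedBall, AddCircle.volume_closedBall, min_eq_right (by linarith), sq]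

lemma tendsto_volume_closedBall_torus (x : Torus2) :
    Tendsto (fun r => volume (Metric.closedBall x r)) (𝓝[>] 0) (𝓝 0) := by
  have hlim : Tendsto (fun r => ENNReal.ofReal (2 * r) ^ 2) (𝓝 0) (𝓝 0) :=
    ((ENNReal.continuous_pow 2).comp (ENNReal.continuous_ofReal.comp
      (continuous_const_mul 2))).tendsto' _ _ (by simp)
  refine (hlim.mono_left nhdsWithin_le_nhds).congr' ?_
  filter_upwards [Ioc_mem_nhdsGT one_half_pos] with r hr
  exact (volume_closedBall_torus x hr.2).symm

lemma le_setLIntegral_closedBall_inv {φ : Torus2 → ℝ} {p : Torus2} {C r : ℝ} (hC : 0 < C)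
    (hφ : ∀ x, φ x ≤ C * ‖x - p‖ ^ 2) (hr : 0 < r) (hr' : r ≤ 1 / 2) :
    ENNReal.ofReal (4 / C) ≤ ∫⁻ x in Metric.closedBall p r, (ENNReal.ofReal (φ x))⁻¹ := by
  have hle : ∀ x ∈ Metric.closedBall p r,
      (ENNReal.ofReal (C * r ^ 2))⁻¹ ≤ (ENNReal.ofReal (φ x))⁻¹ := by
    intro x hx
    rw [mem_closedBall_iff_norm] at hx
    gcongr
    exact (hφ x).trans (by gcongr)
  calc ENNReal.ofReal (4 / C)
      = ENNReal.ofReal ((C * r ^ 2)⁻¹ * (2 * r) ^ 2) := by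
        congr 1
        field_simp
        norm_num
    _ = (ENNReal.ofReal (C * r ^ 2))⁻¹ * volume (Metric.closedBall p r) := by
        rw [volume_closedBall_torus p hr', ENNReal.ofReal_mul (by positivity),
          ENNReal.ofReal_inv_of_pos (by positivity), ENNReal.ofReal_pow (by positivity)]
    _ ≤ ∫⁻ x in Metric.closedBall p r, (ENNReal.ofReal (φ x))⁻¹ := by
        rw [← setLIntegral_const]
        exact setLIntegral_mono' measurableSet_closedBall hle

lemma IsStoppingFunction.lintegral_inv_eq_top {φ : Torus2 → ℝ} {p q : Torus2}
    (h : IsStoppingFunction φ p q) : ∫⁻ x, (ENNReal.ofReal (φ x))⁻¹ = ∞ := by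
  obtain ⟨C, hC, hφ⟩ := h.exists_le_mul_sq
  have hC1 : 0 < C + 1 := by positivity
  have hφ1 (x : Torus2) : φ x ≤ (C + 1) * ‖x - p‖ ^ 2 := (hφ x).trans (by gcongr; linarith)
  by_contra hfin
  have hball : ∀ᶠ r in 𝓝[>] 0, ENNReal.ofReal (4 / (C + 1)) ≤
      ∫⁻ x in Metric.closedBall p r, (ENNReal.ofReal (φ x))⁻¹ := by
    filter_upwards [Ioc_mem_nhdsGT one_half_pos] with r hr
    exact le_setLIntegral_closedBall_inv hC1 hφ1 hr.1 hr.2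
  exact (ge_of_tendsto (tendsto_setLIntegral_zero hfin (tendsto_volume_closedBall_torus p))
    hball).not_gt (ENNReal.ofReal_pos.2 (by positivity))

end Divergence

section Speed

variable {φ : Torus2 → ℝ} {p q : Torus2} {T : Flow ℝ Torus2} {a : ℝ} {x : Torus2} {θ : ℝ → ℝ}

lemma IsStoppingFunction.continuous_inv_add (h : IsStoppingFunction φ p q) {η : ℝ} (hη : 0 < η) :
    Continuous fun x => (φ x + η)⁻¹ :=
  (h.continuous.add continuous_const).inv₀ fun x =>
    (add_pos_of_nonneg_of_pos (h.nonneg x) hη).ne'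

lemma IsParam.continuous (hθ : IsParam φ a x θ) : Continuous θ :=
  continuous_iff_continuousAt.2 fun t => (hθ.hasDerivAt t).continuousAt

lemma IsParam.continuous_orbit (hθ : IsParam φ a x θ) : Continuous fun t => x + line a (θ t) :=
  continuous_const.add ((continuous_line a).comp hθ.continuous)

lemma IsParam.monotone (hθ : IsParam φ a x θ) (hφ : ∀ y, 0 ≤ φ y) : Monotone θ :=
  monotone_of_hasDerivAt_nonneg hθ.hasDerivAt fun _ => hφ _

lemma IsParam.nonneg (hθ : IsParam φ a x θ) (hφ : ∀ y, 0 ≤ φ y) {t : ℝ} (ht : 0 ≤ t) :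
    0 ≤ θ t :=
  hθ.map_zero.symm.trans_le (hθ.monotone hφ ht)

lemma IsParam.integral_comp_mul (hθ : IsParam φ a x θ) (hφ : ∀ y, 0 ≤ φ y) (g : ℝ → ℝ) (t : ℝ) :
    ∫ s in (0 : ℝ)..t, g (θ s) * φ (x + line a (θ s)) = ∫ σ in (0 : ℝ)..θ t, g σ := by
  simpa only [hθ.map_zero, Function.comp_apply] using
    intervalIntegral.integral_comp_mul_deriv_of_deriv_nonneg (a := 0) (b := t) (g := g)
      hθ.continuous.continuousOn (fun s _ => hθ.hasDerivAt s) (fun s _ => hφ _)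

lemma IsParam.integral_inv_le (hθ : IsParam φ a x θ) (h : IsStoppingFunction φ p q) {η : ℝ}
    (hη : 0 < η) {t : ℝ} (ht : 0 ≤ t) :
    ∫ σ in (0 : ℝ)..θ t, (φ (x + line a σ) + η)⁻¹ ≤ t := by
  rw [← hθ.integral_comp_mul h.nonneg (fun σ => (φ (x + line a σ) + η)⁻¹) t]
  have hcont : Continuous fun s => (φ (x + line a (θ s)) + η)⁻¹ * φ (x + line a (θ s)) :=
    ((h.continuous_inv_add hη).comp hθ.continuous_orbit).mul
      (h.continuous.comp hθ.continuous_orbit)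
  have hle : ∀ s, (φ (x + line a (θ s)) + η)⁻¹ * φ (x + line a (θ s)) ≤ 1 := fun s =>
    inv_mul_le_one_of_le₀ (by linarith) (by linarith [h.nonneg (x + line a (θ s))])
  simpa using intervalIntegral.integral_mono (μ := volume) ht (hcont.intervalIntegrable 0 t)
    intervalIntegrable_const hle

/-- The mean of `1 / (φ + η)` along the orbit tends to its space mean, which is arbitrarily
large. -/
lemma IsParam.isLittleO_id (hθ : IsParam φ a x θ) (h : IsStoppingFunction φ p q)
    (ha : Irrational a) : θ =o[atTop] (id : ℝ → ℝ) := by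
  refine Asymptotics.isLittleO_iff.2 fun ε hε => ?_
  obtain ⟨η, hη, hlarge⟩ := exists_le_integral_inv_add h.continuous.measurable h.nonneg
    h.lintegral_inv_eq_top (ε⁻¹ + 1)
  have hmean := (tendsto_average_line ha x ⟨_, h.continuous_inv_add hη⟩).eventually_const_le
    (show ε⁻¹ < ∫ x, (φ x + η)⁻¹ by linarith)
  obtain ⟨S, hS⟩ := eventually_atTop.1 (hmean.and (eventually_gt_atTop 0))
  filter_upwards [eventually_ge_atTop 0, eventually_ge_atTop (S / ε)] with t ht htS
  rw [Real.norm_of_nonneg (hθ.nonneg h.nonneg ht), id, Real.norm_of_nonneg ht]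
  rcases le_total (θ t) S with hle | hle
  · exact hle.trans ((div_le_iff₀' hε).1 htS)
  · obtain ⟨havg, hpos⟩ := hS _ hle
    have htime := ((le_inv_mul_iff₀ hpos).1 havg).trans (hθ.integral_inv_le h hη ht)
    rwa [← div_eq_mul_inv, div_le_iff₀' hε] at htime

end Speed

section Empirical

variable (T : Flow ℝ Torus2) (x : Torus2) (t : ℝ)

lemma intervalIntegrable_comp_flow (f : C(Torus2, ℝ)) (a b : ℝ) :
    IntervalIntegrable (fun s => f (T s x)) volume a b :=
  (f.continuous.comp (T.continuous continuous_id continuous_const)).intervalIntegrable a b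

lemma empirical_add (f g : C(Torus2, ℝ)) :
    empirical T x t (f + g) = empirical T x t f + empirical T x t g := by
  simp only [empirical, ContinuousMap.add_apply, ← mul_add]
  rw [intervalIntegral.integral_add (intervalIntegrable_comp_flow T x f 0 t)
    (intervalIntegrable_comp_flow T x g 0 t)]

lemma empirical_smul (c : ℝ) (f : C(Torus2, ℝ)) :
    empirical T x t (c • f) = c * empirical T x t f := by
  simp only [empirical, ContinuousMap.smul_apply, smul_eq_mul,
    intervalIntegral.integral_const_mul, mul_left_comm]

lemma empirical_const {t : ℝ} (ht : t ≠ 0) (c : ℝ) :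
    empirical T x t (ContinuousMap.const _ c) = c := by
  simp [empirical, ht]

lemma abs_empirical_le {f g : C(Torus2, ℝ)} (hfg : ∀ y, |f y| ≤ g y) {t : ℝ} (ht : 0 ≤ t) :
    |empirical T x t f| ≤ empirical T x t g := by
  rw [empirical, empirical, abs_mul, abs_of_nonneg (inv_nonneg.2 ht)]
  gcongr
  exact intervalIntegral.norm_integral_le_of_norm_le (f := fun s => f (T s x)) ht
    (Eventually.of_forall fun _ _ => hfg _) (intervalIntegrable_comp_flow T x g 0 t)

lemma continuousOn_empirical (f : C(Torus2, ℝ)) :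
    ContinuousOn (fun t => empirical T x t f) (Set.Ioi 0) :=
  (continuousOn_id.inv₀ fun _ ht => (Set.mem_Ioi.1 ht).ne').mul
    (intervalIntegral.continuous_primitive (intervalIntegrable_comp_flow T x f) 0).continuousOn

lemma continuous_empirical (f : C(Torus2, ℝ)) : Continuous fun x => empirical T x t f :=
  continuous_const.mul <|
    intervalIntegral.continuous_parametric_intervalIntegral_of_continuous'
      (f := fun x s => f (T s x))
      (f.continuous.comp (T.continuous continuous_snd continuous_fst)) 0 t

lemma integral_empirical {ν : Measure Torus2} [IsFiniteMeasure ν]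
    (hν : ∀ s, MeasurePreserving (T s) ν ν) (f : C(Torus2, ℝ)) {t : ℝ} (ht : t ≠ 0) :
    ∫ x, empirical T x t f ∂ν = ∫ x, f x ∂ν := by
  have hconst (s : ℝ) : ∫ x, f (T s x) ∂ν = ∫ x, f x ∂ν :=
    (hν s).integral_comp' (f := (T.toHomeomorph s).toMeasurableEquiv) f
  have : IsFiniteMeasure (volume.restrict (Set.uIoc 0 t)) := ⟨by simp⟩
  have hint : Integrable (Function.uncurry fun s x => f (T s x))
      ((volume.restrict (Set.uIoc 0 t)).prod ν) :=
    .of_bound (f.continuous.comp (T.continuous continuous_fst continuous_snd)).aestronglyMeasurable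
      ‖f‖ (Eventually.of_forall fun _ => f.norm_coe_le_norm _)
  simp only [empirical]
  rw [integral_const_mul, ← intervalIntegral_integral_swap hint]
  simp only [hconst, intervalIntegral.integral_const, sub_zero, smul_eq_mul,
    inv_mul_cancel_left₀ ht]

lemma integral_eq_zero_of_tendsto_empirical {ν : Measure Torus2} [IsFiniteMeasure ν]
    (hν : ∀ s, MeasurePreserving (T s) ν ν) (f : C(Torus2, ℝ))
    (hf : ∀ x, Tendsto (fun t => empirical T x t f) atTop (𝓝 0)) : ∫ x, f x ∂ν = 0 := by
  have hlim : Tendsto (fun t => ∫ x, empirical T x t f ∂ν) atTop (𝓝 (∫ _, (0 : ℝ) ∂ν)) := by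
    refine tendsto_integral_filter_of_dominated_convergence (fun _ => ‖f‖)
      (Eventually.of_forall fun t => (continuous_empirical T t f).aestronglyMeasurable) ?_
      (integrable_const _) (Eventually.of_forall hf)
    filter_upwards [eventually_gt_atTop 0] with t ht
    refine Eventually.of_forall fun x => ?_
    simpa only [empirical_const T x ht.ne', Real.norm_eq_abs] using abs_empirical_le T x
      (g := ContinuousMap.const _ ‖f‖) (fun y => f.norm_coe_le_norm y) ht.le
  rw [integral_zero] at hlim
  refine tendsto_nhds_unique (tendsto_const_nhds.congr' ?_) hlim
  filter_upwards [eventually_ne_atTop 0] with t ht using (integral_empirical T hν f ht).symm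

end Empirical

section Fixed

variable {φ : Torus2 → ℝ} {p q : Torus2} {T : Flow ℝ Torus2} {a : ℝ}

lemma IsStoppingFunction.tendsto_empirical_self (h : IsStoppingFunction φ p q)
    (ha : Irrational a) (hT : IsGeneratedBy T φ a) (x : Torus2) :
    Tendsto (fun t => empirical T x t ⟨φ, h.continuous⟩) atTop (𝓝 0) := by
  obtain ⟨θ, hθ, hTθ⟩ := hT.exists_isParam x
  refine (hθ.isLittleO_id h ha).tendsto_div_nhds_zero.congr fun t => ?_
  have hint : ∫ s in (0 : ℝ)..t, φ (T s x) = θ t := by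
    simpa [hTθ] using hθ.integral_comp_mul h.nonneg (fun _ => 1) t
  rw [empirical, id, div_eq_inv_mul]
  exact congrArg _ hint.symm

lemma IsStoppingFunction.tendsto_empirical (h : IsStoppingFunction φ p q) (ha : Irrational a)
    (hT : IsGeneratedBy T φ a) (x : Torus2) (f : C(Torus2, ℝ)) (hp : f p = 0) (hq : f q = 0) :
    Tendsto (fun t => empirical T x t f) atTop (𝓝 0) := by
  refine Metric.tendsto_nhds.2 fun ε hε => ?_
  obtain ⟨C, -, hfφ⟩ := h.exists_abs_le f hp hq (half_pos hε)
  have hsmall := ((h.tendsto_empirical_self ha hT x).const_mul C).eventually_lt_const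
    (show C * 0 < ε / 2 by simpa using hε)
  filter_upwards [hsmall, eventually_gt_atTop 0] with t hCt ht
  have hbound := abs_empirical_le T x (g := .const _ (ε / 2) + C • ⟨φ, h.continuous⟩) hfφ ht.le
  rw [empirical_add, empirical_const T x ht.ne', empirical_smul] at hbound
  rw [Real.dist_0_eq_abs]
  linarith

lemma IsStoppingFunction.mem_diracSegment (h : IsStoppingFunction φ p q) {ν : Measure Torus2}
    [IsProbabilityMeasure ν] (hν : ∫ x, φ x ∂ν = 0) : ν ∈ diracSegment p q := by
  have hsupp : ∀ᵐ x ∂ν, x ∈ ({p} ∪ {q} : Set Torus2) := by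
    filter_upwards [(integral_eq_zero_iff_of_nonneg h.nonneg
      (integrable_of_continuous h.continuous)).1 hν] with x hx
    exact (h.eq_zero_iff x).1 hx
  have hdecomp : ν = ν {p} • Measure.dirac p + ν {q} • Measure.dirac q := by
    conv_lhs => rw [← Measure.restrict_eq_self_of_ae_mem hsupp,
      Measure.restrict_union (by simpa using h.ne) (measurableSet_singleton q),
      Measure.restrict_singleton, Measure.restrict_singleton]
  have hq : ν.real {q} = 1 - ν.real {p} := by
    have hmeas : MeasurableSet ({p} ∪ {q} : Set Torus2) :=
      (measurableSet_singleton p).union (measurableSet_singleton q)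
    rw [eq_sub_iff_add_eq', ← measureReal_union (by simpa using h.ne) (measurableSet_singleton q),
      measureReal_def, (mem_ae_iff_prob_eq_one hmeas).1 hsupp, ENNReal.toReal_one]
  refine ⟨ν.real {p}, measureReal_nonneg, measureReal_le_one, ?_⟩
  rwa [← hq, ofReal_measureReal, ofReal_measureReal]

lemma isProbabilityMeasure_of_mem_diracSegment {ν : Measure Torus2} (hν : ν ∈ diracSegment p q) :
    IsProbabilityMeasure ν := by
  obtain ⟨c, hc0, hc1, rfl⟩ := hν
  constructor
  simp [← ENNReal.ofReal_add hc0 (sub_nonneg.2 hc1)]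

lemma integral_diracSegment {c : ℝ} (hc0 : 0 ≤ c) (hc1 : c ≤ 1) (f : C(Torus2, ℝ)) :
    ∫ y, f y ∂(ENNReal.ofReal c • Measure.dirac p + ENNReal.ofReal (1 - c) • Measure.dirac q) =
      c * f p + (1 - c) * f q := by
  have hint (z : Torus2) (r : ℝ) : Integrable f (ENNReal.ofReal r • Measure.dirac z) :=
    (integrable_of_continuous f.continuous).smul_measure ENNReal.ofReal_ne_top
  rw [integral_add_measure (hint _ _) (hint _ _), integral_smul_measure, integral_smul_measure,
    integral_dirac, integral_dirac, ENNReal.toReal_ofReal hc0,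
    ENNReal.toReal_ofReal (sub_nonneg.2 hc1), smul_eq_mul, smul_eq_mul]

theorem IsStoppingFunction.invariantMeasures_eq (h : IsStoppingFunction φ p q)
    (ha : Irrational a) (hT : IsGeneratedBy T φ a) : invariantMeasures T = diracSegment p q := by
  refine Set.Subset.antisymm ?_ fun ν hν =>
    ⟨isProbabilityMeasure_of_mem_diracSegment hν, fun t => ?_⟩
  · rintro ν ⟨hprob, hinv⟩
    exact h.mem_diracSegment (integral_eq_zero_of_tendsto_empirical T hinv ⟨φ, h.continuous⟩
      (h.tendsto_empirical_self ha hT))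
  · obtain ⟨c, -, -, rfl⟩ := hν
    have hmeas : Measurable (T t) := (T.continuous continuous_const continuous_id).measurable
    refine ⟨hmeas, ?_⟩
    rw [Measure.map_add _ _ hmeas, Measure.map_smul, Measure.map_smul, Measure.map_dirac' hmeas,
      Measure.map_dirac' hmeas, h.flow_left_eq hT, h.symm.flow_left_eq hT]

lemma IsStoppingFunction.accumulationMeasures_subset (h : IsStoppingFunction φ p q)
    (ha : Irrational a) (hT : IsGeneratedBy T φ a) (x : Torus2) :
    accumulationMeasures T x ⊆ diracSegment p q := by
  rintro ν ⟨hprob, τ, hτ, hlim⟩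
  exact h.mem_diracSegment (tendsto_nhds_unique (hlim ⟨φ, h.continuous⟩)
    ((h.tendsto_empirical_self ha hT x).comp hτ))

lemma mapClusterPt_atTop_of_frequently {f : ℝ → ℝ} {c : ℝ} (hf : ContinuousOn f (Set.Ioi 0))
    (hlt : ∀ u > c, ∃ᶠ t in atTop, f t < u) (hgt : ∀ l < c, ∃ᶠ t in atTop, l < f t) :
    MapClusterPt c atTop f := by
  refine mapClusterPt_iff_frequently.2 fun s hs => frequently_atTop.2 fun N => ?_
  obtain ⟨l, u, ⟨hl, hu⟩, hlu⟩ := mem_nhds_iff_exists_Ioo_subset.1 hs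
  obtain ⟨t₁, ht₁, hft₁⟩ := frequently_atTop.1 (hlt u hu) (max N 1)
  obtain ⟨t₂, ht₂, hft₂⟩ := frequently_atTop.1 (hgt l hl) (max N 1)
  by_cases h₁ : l < f t₁
  · exact ⟨t₁, le_of_max_le_left ht₁, hlu ⟨h₁, hft₁⟩⟩
  by_cases h₂ : f t₂ < u
  · exact ⟨t₂, le_of_max_le_left ht₂, hlu ⟨hft₂, h₂⟩⟩
  have hsub : Set.uIcc t₁ t₂ ⊆ Set.Ici (max N 1) := fun t ht => (le_min ht₁ ht₂).trans ht.1
  have hcont : ContinuousOn f (Set.uIcc t₁ t₂) := hf.mono fun t ht =>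
    Set.mem_Ioi.2 (one_pos.trans_le (le_of_max_le_right (hsub ht)))
  obtain ⟨t, ht, rfl⟩ := intermediate_value_uIcc hcont
    (Set.mem_uIcc.2 (Or.inl ⟨(not_lt.1 h₁).trans hl.le, hu.le.trans (not_lt.1 h₂)⟩))
  exact ⟨t, le_of_max_le_left (hsub ht), mem_of_mem_nhds hs⟩

lemma IsStoppingFunction.tendsto_empirical_of_tendsto (h : IsStoppingFunction φ p q)
    (ha : Irrational a) (hT : IsGeneratedBy T φ a) {x : Torus2} {τ : ℕ → ℝ}
    (hτ : Tendsto τ atTop atTop) {g : C(Torus2, ℝ)} (hgp : g p = 1) (hgq : g q = 0) {c : ℝ}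
    (hg : Tendsto (fun n => empirical T x (τ n) g) atTop (𝓝 c)) (f : C(Torus2, ℝ)) :
    Tendsto (fun n => empirical T x (τ n) f) atTop (𝓝 (c * f p + (1 - c) * f q)) := by
  let r : C(Torus2, ℝ) := f - ((f p - f q) • g + .const _ (f q))
  have hr : Tendsto (fun n => empirical T x (τ n) r) atTop (𝓝 0) :=
    (h.tendsto_empirical ha hT x r (by simp [r, hgp]) (by simp [r, hgq])).comp hτ
  have hlim := hr.add ((hg.const_mul (f p - f q)).add_const (f q))
  rw [show 0 + ((f p - f q) * c + f q) = c * f p + (1 - c) * f q by ring] at hlim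
  refine hlim.congr' ?_
  filter_upwards [hτ.eventually_ne_atTop 0] with n hn
  rw [← empirical_smul]
  nth_rewrite 2 [← empirical_const T x hn (f q)]
  rw [← empirical_add, ← empirical_add, sub_add_cancel]

lemma IsStoppingFunction.diracSegment_subset (h : IsStoppingFunction φ p q)
    (ha : Irrational a) (hT : IsGeneratedBy T φ a) {x : Torus2}
    (hp : ∀ g : C(Torus2, ℝ), g p = 0 → ∀ ε > 0, ∃ᶠ t in atTop, empirical T x t g < ε)
    (hq : ∀ g : C(Torus2, ℝ), g q = 0 → ∀ ε > 0, ∃ᶠ t in atTop, empirical T x t g < ε) :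
    diracSegment p q ⊆ accumulationMeasures T x := by
  intro ν hν
  have hprob := isProbabilityMeasure_of_mem_diracSegment hν
  obtain ⟨c, hc0, hc1, rfl⟩ := hν
  obtain ⟨g, hgq, hgp, -⟩ := exists_continuous_zero_one_of_isClosed (isClosed_singleton (x := q))
    (isClosed_singleton (x := p)) (by simpa using h.ne.symm)
  have hgp : g p = 1 := hgp rfl
  have hgq : g q = 0 := hgq rfl
  have hcluster : MapClusterPt c atTop fun t => empirical T x t g := by
    refine mapClusterPt_atTop_of_frequently (continuousOn_empirical T x g)
      (fun u hu => hq g hgq u (hc0.trans_lt hu)) fun l hl => ?_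
    have hcompl := hp (.const _ 1 - g) (by simp [hgp]) (1 - l) (by linarith)
    refine (hcompl.and_eventually (eventually_ne_atTop 0)).mono ?_
    rintro t ⟨hlt, ht⟩
    have hsum := empirical_add T x t (.const _ 1 - g) g
    rw [sub_add_cancel, empirical_const T x ht] at hsum
    linarith
  obtain ⟨τ, hτc, hτ⟩ := hcluster.exists_seq_tendsto
  refine ⟨hprob, τ, hτ, fun f => ?_⟩
  rw [integral_diracSegment hc0 hc1]
  exact h.tendsto_empirical_of_tendsto ha hT hτ hgp hgq hτc f

end Fixed

/-! ### Passages of a line near a point -/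

section Crossing

variable {a σ : ℝ} {z : Torus2} {k : ℤ}

lemma norm_line_le (a σ : ℝ) : ‖line a σ‖ ≤ (1 + |a|) * |σ| := by
  refine max_le ((norm_coe_circle_le σ).trans ?_) ((norm_coe_circle_le (a * σ)).trans ?_)
  · nlinarith [abs_nonneg a, abs_nonneg σ]
  · nlinarith [abs_mul a σ, abs_nonneg σ]

/-- The time in `[k, k + 1)` at which the lines starting at the origin meet the vertical circle
through `z`. -/
def crossingTime (z : Torus2) (k : ℤ) : ℝ := (AddCircle.equivIco 1 0 z.1 : ℝ) + k

lemma coe_crossingTime (z : Torus2) (k : ℤ) : (crossingTime z k : UnitAddCircle) = z.1 := by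
  have hk : ((k : ℝ) : UnitAddCircle) = 0 := (AddCircle.coe_eq_zero_iff 1).2 ⟨k, by simp⟩
  rw [crossingTime, AddCircle.coe_add, hk, add_zero, AddCircle.coe_equivIco]

lemma le_crossingTime (z : Torus2) (k : ℤ) : k ≤ crossingTime z k :=
  le_add_of_nonneg_left (AddCircle.equivIco 1 0 z.1).2.1

lemma crossingTime_lt (z : Torus2) (k : ℤ) : crossingTime z k < k + 1 := by
  linarith [(AddCircle.equivIco 1 0 z.1).2.2, show crossingTime z k = _ + (k : ℝ) from rfl]

/-- The vertical displacement from `z` to the line of slope `a` at time `crossingTime z k`. -/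
def crossing (a : ℝ) (z : Torus2) (k : ℤ) : UnitAddCircle :=
  ((a * crossingTime z k : ℝ) : UnitAddCircle) - z.2

lemma crossing_eq (a : ℝ) (z : Torus2) (k : ℤ) :
    crossing a z k = crossing a z 0 + k • (a : UnitAddCircle) := by
  have hk : k • (a : UnitAddCircle) = ((k * a : ℝ) : UnitAddCircle) := by
    rw [← AddCircle.coe_zsmul, zsmul_eq_mul]
  simp only [crossing, crossingTime, hk, Int.cast_zero, add_zero, mul_add, AddCircle.coe_add,
    mul_comm a (k : ℝ)]
  abel

lemma line_sub_eq (a σ : ℝ) (z : Torus2) (k : ℤ) :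
    line a σ - z = (0, crossing a z k) + line a (σ - crossingTime z k) := by
  have hcross : line a (crossingTime z k) = z + (0, crossing a z k) :=
    Prod.ext (by simp [line, proj, coe_crossingTime]) (by simp [line, proj, crossing])
  conv_lhs => rw [← add_sub_cancel (crossingTime z k) σ, line_add, hcross]
  abel

lemma norm_line_sub_le (a σ : ℝ) (z : Torus2) (k : ℤ) :
    ‖line a σ - z‖ ≤ ‖crossing a z k‖ + (1 + |a|) * |σ - crossingTime z k| := by
  rw [line_sub_eq a σ z k]
  refine (norm_add_le _ _).trans (add_le_add (max_le ?_ le_rfl) (norm_line_le a _))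
  simp

lemma norm_crossing_le (a σ : ℝ) (z : Torus2) (k : ℤ) :
    ‖crossing a z k‖ ≤ ‖line a σ - z‖ + |a| * |σ - crossingTime z k| := by
  have hsnd : crossing a z k =
      (line a σ - z).2 - ((a * (σ - crossingTime z k) : ℝ) : UnitAddCircle) := by
    rw [line_sub_eq a σ z k]
    exact (add_sub_cancel_right _ _).symm
  rw [hsnd, ← abs_mul]
  exact (norm_sub_le _ _).trans (add_le_add (norm_snd_le _) (norm_coe_circle_le _))

lemma exists_abs_sub_crossingTime_le (σ : ℝ) (z : Torus2) :
    ∃ k, |σ - crossingTime z k| ≤ 1 / 2 := by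
  refine ⟨round (σ - crossingTime z 0), ?_⟩
  have h := abs_sub_round (σ - crossingTime z 0)
  simp only [crossingTime, Int.cast_zero, add_zero] at h ⊢
  rwa [← sub_sub]

lemma abs_sub_crossingTime_le (hσ : |σ - crossingTime z k| ≤ 1 / 2) :
    |σ - crossingTime z k| ≤ ‖line a σ - z‖ := by
  have hfst : ‖((σ - crossingTime z k : ℝ) : UnitAddCircle)‖ = |σ - crossingTime z k| :=
    (AddCircle.norm_coe_eq_abs_iff 1 one_ne_zero).2 (by simpa using hσ)
  rw [← hfst, AddCircle.coe_sub, coe_crossingTime]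
  exact norm_fst_le (line a σ - z)

lemma crossing_sq_add_sq_le (hσ : |σ - crossingTime z k| ≤ 1 / 2) :
    ‖crossing a z k‖ ^ 2 + (σ - crossingTime z k) ^ 2 ≤
      ((1 + |a|) ^ 2 + 1) * ‖line a σ - z‖ ^ 2 := by
  have hfst := abs_sub_crossingTime_le (a := a) hσ
  have hsnd : ‖crossing a z k‖ ≤ (1 + |a|) * ‖line a σ - z‖ := by
    nlinarith [norm_crossing_le a σ z k, abs_nonneg a]
  calc ‖crossing a z k‖ ^ 2 + (σ - crossingTime z k) ^ 2
      ≤ ((1 + |a|) * ‖line a σ - z‖) ^ 2 + ‖line a σ - z‖ ^ 2 := by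
        rw [← sq_abs (σ - _)]
        gcongr
    _ = ((1 + |a|) ^ 2 + 1) * ‖line a σ - z‖ ^ 2 := by ring

lemma line_ne (hz : ∀ k, crossing a z k ≠ 0) (σ : ℝ) : line a σ ≠ z := by
  obtain ⟨k, hk⟩ := exists_abs_sub_crossingTime_le σ z
  intro h
  have hsq := crossing_sq_add_sq_le (a := a) hk
  rw [h, sub_self, norm_zero] at hsq
  nlinarith [norm_pos_iff.2 (hz k), sq_nonneg (σ - crossingTime z k)]

end Crossing

section CrossingSum

variable {a : ℝ} {z : Torus2}

lemma continuous_inv_sq_add_sq {d : ℝ} (hd : 0 < d) (s : ℝ) :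
    Continuous fun σ => (d ^ 2 + (σ - s) ^ 2)⁻¹ :=
  Continuous.inv₀ (by fun_prop) fun σ => by positivity

lemma integral_inv_sq_add_sq_le {d : ℝ} (hd : 0 < d) (s A B : ℝ) :
    ∫ σ in A..B, (d ^ 2 + (σ - s) ^ 2)⁻¹ ≤ Real.pi * d⁻¹ := by
  have hderiv (σ : ℝ) : HasDerivAt (fun σ => d⁻¹ * Real.arctan ((σ - s) / d))
      (d ^ 2 + (σ - s) ^ 2)⁻¹ σ := by
    have harctan := ((((hasDerivAt_id σ).sub_const s).div_const d).arctan).const_mul d⁻¹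
    refine harctan.congr_deriv ?_
    rw [id]
    field_simp
  rw [intervalIntegral.integral_eq_sub_of_hasDerivAt (fun σ _ => hderiv σ)
    ((continuous_inv_sq_add_sq hd s).intervalIntegrable A B), ← mul_sub, mul_comm]
  gcongr
  linarith [Real.arctan_lt_pi_div_two ((B - s) / d), Real.neg_pi_div_two_lt_arctan ((A - s) / d)]

/-- The total inverse distance to `0` of the points `v + k • α` of the orbit of a rotation, for
`-1 ≤ k ≤ n + 1`. -/
def crossingSum (α v : UnitAddCircle) (n : ℕ) : ℝ :=
  ∑ k ∈ Finset.Icc (-1 : ℤ) (n + 1), ‖v + k • α‖⁻¹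

lemma crossingSum_nonneg (α v : UnitAddCircle) (n : ℕ) : 0 ≤ crossingSum α v n :=
  Finset.sum_nonneg fun _ _ => inv_nonneg.2 (norm_nonneg _)

lemma inv_sq_norm_line_sub_le (hz : ∀ k, crossing a z k ≠ 0) {n : ℕ} {σ : ℝ}
    (hσ : σ ∈ Set.Icc (0 : ℝ) (n + 1)) :
    (‖line a σ - z‖ ^ 2)⁻¹ ≤ ((1 + |a|) ^ 2 + 1) *
      ∑ k ∈ Finset.Icc (-1 : ℤ) (n + 1), (‖crossing a z k‖ ^ 2 + (σ - crossingTime z k) ^ 2)⁻¹ := by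
  obtain ⟨k, hk⟩ := exists_abs_sub_crossingTime_le σ z
  have hmem : k ∈ Finset.Icc (-1 : ℤ) (n + 1) := by
    obtain ⟨hlower, hupper⟩ := abs_le.1 hk
    rw [Finset.mem_Icc, ← Int.lt_add_one_iff (a := k)]
    have hleft : (-2 : ℝ) < k := by linarith [hσ.1, crossingTime_lt z k]
    have hright : (k : ℝ) < n + 2 := by linarith [hσ.2, le_crossingTime z k]
    exact ⟨by exact_mod_cast hleft, by
      rw [add_assoc]
      exact_mod_cast hright⟩
  have hpos : 0 < ‖crossing a z k‖ := norm_pos_iff.2 (hz k)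
  have hline : 0 < ‖line a σ - z‖ := norm_pos_iff.2 (sub_ne_zero.2 (line_ne hz σ))
  calc (‖line a σ - z‖ ^ 2)⁻¹
      ≤ ((1 + |a|) ^ 2 + 1) * (‖crossing a z k‖ ^ 2 + (σ - crossingTime z k) ^ 2)⁻¹ := by
        rw [inv_le_iff_one_le_mul₀ (by positivity), mul_right_comm, ← div_eq_mul_inv,
          one_le_div (by positivity)]
        exact crossing_sq_add_sq_le hk
    _ ≤ _ := by
        gcongr
        exact Finset.single_le_sum
          (f := fun k => (‖crossing a z k‖ ^ 2 + (σ - crossingTime z k) ^ 2)⁻¹)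
          (fun k _ => by positivity) hmem

lemma continuous_inv_sq_norm_line_sub (hz : ∀ k, crossing a z k ≠ 0) :
    Continuous fun σ => (‖line a σ - z‖ ^ 2)⁻¹ :=
  (((continuous_line a).sub continuous_const).norm.pow 2).inv₀ fun σ =>
    pow_ne_zero 2 (norm_ne_zero_iff.2 (sub_ne_zero.2 (line_ne hz σ)))

lemma integral_inv_sq_le_crossingSum (hz : ∀ k, crossing a z k ≠ 0) {n : ℕ} {s : ℝ}
    (hs : s ∈ Set.Icc (0 : ℝ) (n + 1)) :
    ∫ σ in 0..s, (‖line a σ - z‖ ^ 2)⁻¹ ≤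
      ((1 + |a|) ^ 2 + 1) * (Real.pi * crossingSum a (crossing a z 0) n) := by
  have hcont (k : ℤ) := continuous_inv_sq_add_sq (norm_pos_iff.2 (hz k)) (crossingTime z k)
  calc ∫ σ in 0..s, (‖line a σ - z‖ ^ 2)⁻¹
      ≤ ∫ σ in 0..s, ((1 + |a|) ^ 2 + 1) * ∑ k ∈ Finset.Icc (-1 : ℤ) (n + 1),
          (‖crossing a z k‖ ^ 2 + (σ - crossingTime z k) ^ 2)⁻¹ :=
        intervalIntegral.integral_mono_on hs.1
          ((continuous_inv_sq_norm_line_sub hz).intervalIntegrable _ _)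
          ((continuous_const.mul (continuous_finsetSum _ fun k _ => hcont k)).intervalIntegrable
            _ _)
          fun σ hσ => inv_sq_norm_line_sub_le hz ⟨hσ.1, hσ.2.trans hs.2⟩
    _ = ((1 + |a|) ^ 2 + 1) * ∑ k ∈ Finset.Icc (-1 : ℤ) (n + 1),
          ∫ σ in 0..s, (‖crossing a z k‖ ^ 2 + (σ - crossingTime z k) ^ 2)⁻¹ := by
        rw [intervalIntegral.integral_const_mul,
          intervalIntegral.integral_finsetSum fun k _ => (hcont k).intervalIntegrable _ _]
    _ ≤ ((1 + |a|) ^ 2 + 1) *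
          ∑ k ∈ Finset.Icc (-1 : ℤ) (n + 1), Real.pi * ‖crossing a z k‖⁻¹ := by
        gcongr with k
        exact integral_inv_sq_add_sq_le (norm_pos_iff.2 (hz k)) _ _ _
    _ = _ := by simp_rw [crossingSum, Finset.mul_sum, ← crossing_eq]

end CrossingSum

/-! ### Dominant passages -/

section Passage

variable {φ : Torus2 → ℝ} {p q : Torus2} {T : Flow ℝ Torus2} {a : ℝ} {x : Torus2} {θ : ℝ → ℝ}

lemma add_line_sub (x z : Torus2) (a σ : ℝ) : x + line a σ - z = line a σ - (z - x) := by
  abel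

lemma IsStoppingFunction.exists_add_sq_le (h : IsStoppingFunction φ p q) (a : ℝ) :
    ∃ K, 0 < K ∧ ∀ x k σ, |σ - crossingTime (p - x) k| ≤ ‖crossing a (p - x) k‖ →
      φ (x + line a σ) + ‖crossing a (p - x) k‖ ^ 2 ≤ K * ‖crossing a (p - x) k‖ ^ 2 := by
  obtain ⟨C, hC, hφ⟩ := h.exists_le_mul_sq
  refine ⟨C * (2 + |a|) ^ 2 + 1, by positivity, fun x k σ hσ => ?_⟩
  have hdist : ‖x + line a σ - p‖ ≤ (2 + |a|) * ‖crossing a (p - x) k‖ := by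
    rw [add_line_sub]
    nlinarith [norm_line_sub_le a σ (p - x) k, abs_nonneg a]
  calc φ (x + line a σ) + ‖crossing a (p - x) k‖ ^ 2
      ≤ C * ((2 + |a|) * ‖crossing a (p - x) k‖) ^ 2 + ‖crossing a (p - x) k‖ ^ 2 := by
        grw [hφ, hdist]
    _ = (C * (2 + |a|) ^ 2 + 1) * ‖crossing a (p - x) k‖ ^ 2 := by ring

lemma IsParam.exists_inv_norm_crossing_le (hθ : IsParam φ a x θ) (h : IsStoppingFunction φ p q) :
    ∃ K, 0 < K ∧ ∀ t k, 0 ≤ t → 1 ≤ k → crossing a (p - x) k ≠ 0 →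
      θ t = crossingTime (p - x) k → ‖crossing a (p - x) k‖⁻¹ ≤ K * t := by
  obtain ⟨K, hK, hφ⟩ := h.exists_add_sq_le a
  refine ⟨K, hK, fun t k ht hk hcross htime => ?_⟩
  set d := ‖crossing a (p - x) k‖
  have hd : 0 < d := norm_pos_iff.2 hcross
  have hstart : 0 ≤ θ t - d := by
    have hk' : (1 : ℝ) ≤ k := by exact_mod_cast hk
    linarith [norm_circle_le_half (crossing a (p - x) k), le_crossingTime (p - x) k]
  have hint (A B : ℝ) :
      IntervalIntegrable (fun σ => (φ (x + line a σ) + d ^ 2)⁻¹) volume A B :=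
    ((h.continuous_inv_add (by positivity)).comp
      (continuous_const.add (continuous_line a))).intervalIntegrable A B
  have hnonneg (y : Torus2) : 0 ≤ (φ y + d ^ 2)⁻¹ := by
    have := h.nonneg y
    positivity
  have htime_near : (K * d)⁻¹ ≤ t := calc
    (K * d)⁻¹ = ∫ _ in (θ t - d)..θ t, (K * d ^ 2)⁻¹ := by
        rw [intervalIntegral.integral_const, sub_sub_cancel, smul_eq_mul]
        field_simp
    _ ≤ ∫ σ in (θ t - d)..θ t, (φ (x + line a σ) + d ^ 2)⁻¹ := by
        refine intervalIntegral.integral_mono_on (by linarith) (by simp) (hint _ _) fun σ hσ => ?_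
        have := h.nonneg (x + line a σ)
        refine inv_anti₀ (by positivity) (hφ x k σ ?_)
        rw [← htime, abs_le]
        exact ⟨by linarith [hσ.1], by linarith [hσ.2]⟩
    _ ≤ ∫ σ in 0..θ t, (φ (x + line a σ) + d ^ 2)⁻¹ :=
        intervalIntegral.integral_mono_interval hstart (by linarith) le_rfl
          (Eventually.of_forall fun σ => hnonneg _) (hint _ _)
    _ ≤ t := hθ.integral_inv_le h (by positivity) ht
  rw [mul_inv, ← div_eq_inv_mul, div_le_iff₀ hK] at htime_near
  linarith

lemma IsParam.exists_eq (hθ : IsParam φ a x θ) (h : IsStoppingFunction φ p q)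
    (hp : ∀ σ, x + line a σ ≠ p) (hq : ∀ σ, x + line a σ ≠ q) {s : ℝ} (hs : 0 ≤ s) :
    ∃ t, 0 ≤ t ∧ θ t = s := by
  have hne (σ : ℝ) : φ (x + line a σ) ≠ 0 := by
    simp [h.eq_zero_iff, hp σ, hq σ]
  have hcont : Continuous fun σ => (φ (x + line a σ))⁻¹ :=
    (h.continuous.comp (continuous_const.add (continuous_line a))).inv₀ hne
  have hnonneg (σ : ℝ) : 0 ≤ (φ (x + line a σ))⁻¹ := inv_nonneg.2 (h.nonneg _)
  set t := (∫ σ in 0..s, (φ (x + line a σ))⁻¹) + 1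
  have ht : 0 ≤ t :=
    add_nonneg (intervalIntegral.integral_nonneg hs fun σ _ => hnonneg σ) one_pos.le
  have hduration : ∫ σ in 0..θ t, (φ (x + line a σ))⁻¹ = t := by
    rw [← hθ.integral_comp_mul h.nonneg]
    simp [inv_mul_cancel₀ (hne _)]
  have hreach : s ≤ θ t := by
    by_contra! hlt
    have hle : ∫ σ in 0..θ t, (φ (x + line a σ))⁻¹ ≤ ∫ σ in 0..s, (φ (x + line a σ))⁻¹ :=
      intervalIntegral.integral_mono_interval le_rfl (hθ.nonneg h.nonneg ht) hlt.le
        (Eventually.of_forall hnonneg) (hcont.intervalIntegrable _ _)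
    linarith [show t = (∫ σ in 0..s, (φ (x + line a σ))⁻¹) + 1 from rfl]
  obtain ⟨r, hr, hrs⟩ :=
    intermediate_value_Icc ht hθ.continuous.continuousOn ⟨hθ.map_zero.trans_le hs, hreach⟩
  exact ⟨r, hr.1, hrs⟩

lemma IsParam.exists_tendsto_atTop (hθ : IsParam φ a x θ) (h : IsStoppingFunction φ p q)
    (hp : ∀ σ, x + line a σ ≠ p) (hq : ∀ σ, x + line a σ ≠ q) {s : ℕ → ℝ} (hs : ∀ n, 0 ≤ s n)
    (hlim : Tendsto s atTop atTop) :
    ∃ t : ℕ → ℝ, (∀ n, 0 ≤ t n) ∧ (∀ n, θ (t n) = s n) ∧ Tendsto t atTop atTop := by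
  choose t ht hts using fun n => hθ.exists_eq h hp hq (hs n)
  refine ⟨t, ht, hts, tendsto_atTop.2 fun b => ?_⟩
  filter_upwards [hlim.eventually_gt_atTop (θ b)] with n hn
  exact ((hθ.monotone h.nonneg).reflect_lt (hn.trans_eq (hts n).symm)).le

lemma IsParam.integral_le (hθ : IsParam φ a x θ) (hφ : ∀ y, 0 ≤ φ y) {g : C(Torus2, ℝ)}
    {ε C : ℝ} (hg : ∀ y, |g y| * ‖y - q‖ ^ 2 ≤ ε * ‖y - q‖ ^ 2 + C * φ y)
    (hq : ∀ k, crossing a (q - x) k ≠ 0) (hcont : Continuous φ) {t : ℝ} (ht : 0 ≤ t) :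
    ∫ s in 0..t, g (x + line a (θ s)) ≤
      ε * t + C * ∫ σ in 0..θ t, (‖line a σ - (q - x)‖ ^ 2)⁻¹ := by
  have hinv := continuous_inv_sq_norm_line_sub hq
  have hpoint (s : ℝ) : g (x + line a (θ s)) ≤
      ε + C * ((‖line a (θ s) - (q - x)‖ ^ 2)⁻¹ * φ (x + line a (θ s))) := by
    have hpos : 0 < ‖line a (θ s) - (q - x)‖ ^ 2 :=
      pow_pos (norm_pos_iff.2 (sub_ne_zero.2 (line_ne hq _))) 2
    have hgs := hg (x + line a (θ s))
    rw [add_line_sub, ← le_div_iff₀ hpos] at hgs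
    refine (le_abs_self _).trans (hgs.trans_eq ?_)
    rw [add_div, mul_div_cancel_right₀ _ hpos.ne', mul_div_assoc, div_eq_inv_mul]
  have hterm : Continuous fun s =>
      C * ((‖line a (θ s) - (q - x)‖ ^ 2)⁻¹ * φ (x + line a (θ s))) :=
    continuous_const.mul ((hinv.comp hθ.continuous).mul (hcont.comp hθ.continuous_orbit))
  calc ∫ s in 0..t, g (x + line a (θ s))
      ≤ ∫ s in 0..t, (ε + C * ((‖line a (θ s) - (q - x)‖ ^ 2)⁻¹ * φ (x + line a (θ s)))) :=
        intervalIntegral.integral_mono ht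
          ((g.continuous.comp hθ.continuous_orbit).intervalIntegrable _ _)
          ((continuous_const.add hterm).intervalIntegrable _ _) hpoint
    _ = ε * t + C * ∫ σ in 0..θ t, (‖line a σ - (q - x)‖ ^ 2)⁻¹ := by
        rw [intervalIntegral.integral_add (by simp) (hterm.intervalIntegrable _ _),
          intervalIntegral.integral_const, intervalIntegral.integral_const_mul, sub_zero,
          smul_eq_mul, mul_comm t,
          hθ.integral_comp_mul hφ fun σ => (‖line a σ - (q - x)‖ ^ 2)⁻¹]

lemma IsParam.exists_empirical_le (hθ : IsParam φ a x θ) (h : IsStoppingFunction φ p q)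
    (hT : ∀ t, T t x = x + line a (θ t)) (hp : ∀ k, crossing a (p - x) k ≠ 0)
    (hq : ∀ k, crossing a (q - x) k ≠ 0) {g : C(Torus2, ℝ)} (hg : g p = 0) {ε : ℝ} (hε : 0 < ε) :
    ∃ M, 0 ≤ M ∧ ∀ t, ∀ n : ℕ, 0 ≤ t → 1 ≤ n → θ t = crossingTime (p - x) n →
      empirical T x t g ≤
        ε + M * (‖crossing a (p - x) n‖ * crossingSum a (crossing a (q - x) 0) n) := by
  obtain ⟨C, hC, hCg⟩ := h.exists_abs_mul_sq_le g hg hε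
  obtain ⟨K, hK, hKt⟩ := hθ.exists_inv_norm_crossing_le h
  refine ⟨C * (((1 + |a|) ^ 2 + 1) * Real.pi) * K, by positivity, fun t n ht hn hθt => ?_⟩
  set d := ‖crossing a (p - x) n‖
  set S := crossingSum a (crossing a (q - x) 0) n
  have hS : 0 ≤ S := crossingSum_nonneg _ _ _
  have hd : 0 < d := norm_pos_iff.2 (hp n)
  have hdt : d⁻¹ ≤ K * t := hKt t n ht (by exact_mod_cast hn) (hp n) hθt
  have ht0 : 0 < t := pos_of_mul_pos_right ((inv_pos.2 hd).trans_le hdt) hK.le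
  have hpassages : ∫ σ in 0..θ t, (‖line a σ - (q - x)‖ ^ 2)⁻¹ ≤
      ((1 + |a|) ^ 2 + 1) * (Real.pi * S) :=
    integral_inv_sq_le_crossingSum hq ⟨hθ.nonneg h.nonneg ht, by
      rw [hθt]
      exact_mod_cast (crossingTime_lt (p - x) n).le⟩
  rw [empirical, inv_mul_le_iff₀ ht0]
  simp_rw [hT]
  calc ∫ s in 0..t, g (x + line a (θ s))
      ≤ ε * t + C * (((1 + |a|) ^ 2 + 1) * (Real.pi * S)) * 1 := by
        rw [mul_one]
        grw [hθ.integral_le h.nonneg hCg hq h.continuous ht, hpassages]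
    _ ≤ ε * t + C * (((1 + |a|) ^ 2 + 1) * (Real.pi * S)) * (K * t * d) := by
        gcongr
        rwa [inv_le_iff_one_le_mul₀ hd] at hdt
    _ = t * (ε + C * (((1 + |a|) ^ 2 + 1) * Real.pi) * K * (d * S)) := by ring

/-- Infinitely often, the `n`-th point of the orbit of `u` under the rotation by `α` is so close to
`0` that the inverse of its distance dwarfs the total inverse distance of the orbit of `v` up to
time `n + 1`. Neither orbit hits `0`. -/
structure IsDominant (α u v : UnitAddCircle) : Prop where
  left_ne_zero : ∀ k : ℤ, u + k • α ≠ 0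
  right_ne_zero : ∀ k : ℤ, v + k • α ≠ 0
  frequently_lt : ∀ ε > 0, ∃ᶠ n : ℕ in atTop, ‖u + (n : ℤ) • α‖ * crossingSum α v n < ε

theorem IsDominant.frequently_empirical_lt (h : IsStoppingFunction φ p q)
    (hT : IsGeneratedBy T φ a) (hD : IsDominant a (crossing a (p - x) 0) (crossing a (q - x) 0))
    {g : C(Torus2, ℝ)} (hg : g p = 0) {ε : ℝ} (hε : 0 < ε) :
    ∃ᶠ t in atTop, empirical T x t g < ε := by
  obtain ⟨θ, hθ, hTθ⟩ := hT.exists_isParam x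
  have hp (k : ℤ) : crossing a (p - x) k ≠ 0 := crossing_eq a (p - x) k ▸ hD.left_ne_zero k
  have hq (k : ℤ) : crossing a (q - x) k ≠ 0 := crossing_eq a (q - x) k ▸ hD.right_ne_zero k
  have hne {z : Torus2} (hz : ∀ k, crossing a (z - x) k ≠ 0) (σ : ℝ) : x + line a σ ≠ z :=
    fun hσ => line_ne hz σ (eq_sub_of_add_eq' hσ)
  obtain ⟨M, hM, hempirical⟩ := hθ.exists_empirical_le h hTθ hp hq hg (half_pos hε)
  obtain ⟨t, ht, hθt, htop⟩ := hθ.exists_tendsto_atTop h (hne hp) (hne hq)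
    (s := fun n => crossingTime (p - x) n)
    (fun n => (Nat.cast_nonneg n).trans (le_crossingTime _ _))
    (tendsto_atTop_mono (fun n => le_crossingTime _ _) tendsto_natCast_atTop_atTop)
  have hdominant := hD.frequently_lt (ε / (2 * (M + 1))) (by positivity)
  refine htop.frequently ((hdominant.and_eventually (eventually_ge_atTop 1)).mono ?_)
  rintro n ⟨hn, hn1⟩
  rw [← crossing_eq, lt_div_iff₀ (by positivity)] at hn
  refine (hempirical _ n (ht n) hn1 (hθt n)).trans_lt ?_
  nlinarith [mul_nonneg (norm_nonneg (crossing a (p - x) n))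
    (crossingSum_nonneg a (crossing a (q - x) 0) n)]

end Passage

/-! ### A Borel–Cantelli lemma for pairwise independent events -/

section BorelCantelli

open ProbabilityTheory

variable {Ω : Type*} [MeasurableSpace Ω] {μ : Measure Ω}

lemma indepFun_indicator_of_indepSet {s t : Set Ω} (h : IndepSet s t μ) :
    IndepFun (s.indicator (1 : Ω → ℝ)) (t.indicator (1 : Ω → ℝ)) μ := by
  have hle (s : Set Ω) : MeasurableSpace.comap (s.indicator (1 : Ω → ℝ)) inferInstance ≤
      MeasurableSpace.generateFrom {s} :=
    ((@measurable_const ℝ Ω _ (.generateFrom {s}) 1).indicator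
      (MeasurableSpace.measurableSet_generateFrom rfl)).comap_le
  exact indep_of_indep_of_le_left (indep_of_indep_of_le_right h (hle t)) (hle s)

variable {ι : Type*} {A B : ι → Set Ω}

lemma memLp_indicator_one [IsFiniteMeasure μ] {s : Set Ω} (hs : MeasurableSet s)
    (r : ENNReal) : MemLp (s.indicator (1 : Ω → ℝ)) r μ :=
  (memLp_const (1 : ℝ)).indicator hs

lemma integrable_indicator_one [IsFiniteMeasure μ] {s : Set Ω} (hs : MeasurableSet s) :
    Integrable (s.indicator (1 : Ω → ℝ)) μ :=
  memLp_one_iff_integrable.1 (memLp_indicator_one hs 1)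

lemma integral_sum_indicator_one [IsFiniteMeasure μ] (hA : ∀ i, MeasurableSet (A i))
    (s : Finset ι) :
    ∫ ω, (∑ i ∈ s, (A i).indicator (1 : Ω → ℝ)) ω ∂μ = ∑ i ∈ s, μ.real (A i) := by
  simp_rw [Finset.sum_apply]
  rw [integral_finsetSum _ fun i _ => integrable_indicator_one (hA i)]
  exact Finset.sum_congr rfl fun i _ => integral_indicator_one (hA i)

lemma variance_sum_indicator_one_le [IsProbabilityMeasure μ] (hA : ∀ i, MeasurableSet (A i))
    (hind : Pairwise fun i j => IndepSet (A i) (A j) μ) (s : Finset ι) :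
    Var[∑ i ∈ s, (A i).indicator (1 : Ω → ℝ); μ] ≤ ∑ i ∈ s, μ.real (A i) := by
  rw [IndepFun.variance_sum (fun i _ => memLp_indicator_one (hA i) 2)
    fun i _ j _ hij => indepFun_indicator_of_indepSet (hind hij)]
  refine Finset.sum_le_sum fun i _ => ?_
  refine (variance_le_expectation_sq (integrable_indicator_one (hA i)).1).trans_eq ?_
  have hsq : (A i).indicator (1 : Ω → ℝ) ^ 2 = (A i).indicator 1 := by
    funext ω
    by_cases hω : ω ∈ A i <;> simp [hω]
  rw [hsq, integral_indicator_one (hA i)]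

variable [IsProbabilityMeasure μ] {δ : ℝ}

lemma measureReal_half_le_abs_sum_indicator_sub_le (hA : ∀ i, MeasurableSet (A i))
    (hind : Pairwise fun i j => IndepSet (A i) (A j) μ) (s : Finset ι)
    (hs : 0 < ∑ i ∈ s, μ.real (A i)) :
    μ.real {ω | (∑ i ∈ s, μ.real (A i)) / 2 ≤
      |(∑ i ∈ s, (A i).indicator (1 : Ω → ℝ)) ω - ∑ i ∈ s, μ.real (A i)|} ≤
      4 / ∑ i ∈ s, μ.real (A i) := by
  have hmemLp : MemLp (∑ i ∈ s, (A i).indicator (1 : Ω → ℝ)) 2 μ :=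
    memLp_finsetSum' _ fun i _ => memLp_indicator_one (hA i) 2
  have hchebyshev := meas_ge_le_variance_div_sq (μ := μ) hmemLp (half_pos hs)
  simp only [integral_sum_indicator_one (μ := μ) hA] at hchebyshev
  refine ENNReal.toReal_le_of_le_ofReal (by positivity)
    (hchebyshev.trans (ENNReal.ofReal_le_ofReal ?_))
  grw [variance_sum_indicator_one_le hA hind s]
  refine le_of_eq ?_
  field_simp
  norm_num

lemma measureReal_half_le_sum_indicator_le (hA : ∀ i, MeasurableSet (A i)) (s : Finset ι) {e : ℝ}
    (he : 0 < e) (hle : ∑ i ∈ s, μ.real (A i) ≤ δ * e) :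
    μ.real {ω | e / 2 ≤ (∑ i ∈ s, (A i).indicator (1 : Ω → ℝ)) ω} ≤ 2 * δ := by
  have hnonneg : 0 ≤ ∑ i ∈ s, (A i).indicator (1 : Ω → ℝ) :=
    Finset.sum_nonneg fun i _ => Set.indicator_nonneg fun _ _ => zero_le_one
  have hmarkov := mul_meas_ge_le_integral_of_nonneg (Eventually.of_forall hnonneg)
    (integrable_finsetSum' (μ := μ) s fun i _ => integrable_indicator_one (hA i)) (e / 2)
  rw [integral_sum_indicator_one hA] at hmarkov
  exact le_of_mul_le_mul_left (by linarith) (half_pos he)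

/-- If no `A i ∩ B i` occurs, then the number of `A i` that occur equals the number of `A i \ B i`
that do. The former is unlikely to be less than half its mean by Chebyshev, the latter is unlikely
to be more than that by Markov. -/
lemma measureReal_forall_notMem_inter_le (hA : ∀ i, MeasurableSet (A i))
    (hB : ∀ i, MeasurableSet (B i)) (hind : Pairwise fun i j => IndepSet (A i) (A j) μ)
    (hAB : ∀ i, μ.real (A i \ B i) ≤ δ * μ.real (A i)) (s : Finset ι)
    (hs : 0 < ∑ i ∈ s, μ.real (A i)) :
    μ.real {ω | ∀ i ∈ s, ω ∉ A i ∩ B i} ≤ 4 / (∑ i ∈ s, μ.real (A i)) + 2 * δ := by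
  have hsum : ∑ i ∈ s, μ.real (A i \ B i) ≤ δ * ∑ i ∈ s, μ.real (A i) := by
    rw [Finset.mul_sum]
    exact Finset.sum_le_sum fun i _ => hAB i
  refine (measureReal_mono fun ω hω => ?_).trans ((measureReal_union_le _ _).trans
    (add_le_add (measureReal_half_le_abs_sum_indicator_sub_le hA hind s hs)
      (measureReal_half_le_sum_indicator_le (fun i => (hA i).diff (hB i)) s hs hsum)))
  have hcount : (∑ i ∈ s, (A i).indicator (1 : Ω → ℝ)) ω =
      (∑ i ∈ s, (A i \ B i).indicator (1 : Ω → ℝ)) ω := by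
    simp only [Finset.sum_apply]
    refine Finset.sum_congr rfl fun i hi => ?_
    have hiff : ω ∈ A i ↔ ω ∈ A i \ B i := ⟨fun h => ⟨h, fun hBi => hω i hi ⟨h, hBi⟩⟩, And.left⟩
    by_cases h : ω ∈ A i
    · rw [Set.indicator_of_mem h, Set.indicator_of_mem (hiff.1 h)]
    · rw [Set.indicator_of_notMem h, Set.indicator_of_notMem (mt hiff.2 h)]
  refine or_iff_not_imp_right.2 fun hlt => ?_
  simp only [Set.mem_ofPred_eq, not_le, hcount] at hlt ⊢
  rw [abs_sub_comm]
  exact (le_abs_self _).trans' (by linarith)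

theorem measure_not_frequently_mem_inter_le {A B : ℕ → Set Ω} (hA : ∀ n, MeasurableSet (A n))
    (hB : ∀ n, MeasurableSet (B n)) (hind : Pairwise fun m n => IndepSet (A m) (A n) μ)
    (hAB : ∀ n, μ.real (A n \ B n) ≤ δ * μ.real (A n))
    (hsum : ¬ Summable fun n => μ.real (A n)) :
    μ {ω | ¬ ∃ᶠ n in atTop, ω ∈ A n ∩ B n} ≤ ENNReal.ofReal (2 * δ) := by
  set D : ℕ → Set Ω := fun N => {ω | ∀ n ≥ N, ω ∉ A n ∩ B n} with hD
  have hunion : {ω | ¬ ∃ᶠ n in atTop, ω ∈ A n ∩ B n} = ⋃ N, D N := by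
    ext ω
    simp only [hD, not_frequently, eventually_atTop, Set.mem_ofPred_eq, Set.mem_iUnion]
  have hmono : Monotone D := fun N M hNM ω hω n hn => hω n (hNM.trans hn)
  rw [hunion, hmono.measure_iUnion]
  refine iSup_le fun N => ?_
  have hdiv : Tendsto (fun M => ∑ k ∈ Finset.range M, μ.real (A (k + N))) atTop atTop :=
    (not_summable_iff_tendsto_nat_atTop_of_nonneg fun _ => measureReal_nonneg).1
      (mt (summable_nat_add_iff (f := fun n => μ.real (A n)) N).1 hsum)
  have hlim : Tendsto (fun M => 4 / (∑ k ∈ Finset.range M, μ.real (A (k + N))) + 2 * δ) atTop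
      (𝓝 (2 * δ)) := by
    simpa only [zero_add] using (hdiv.const_div_atTop 4).add_const (2 * δ)
  have hle : μ.real (D N) ≤ 2 * δ := by
    refine ge_of_tendsto hlim ((hdiv.eventually_gt_atTop 0).mono fun M hM => ?_)
    have hsubset : D N ⊆ {ω | ∀ k ∈ Finset.range M, ω ∉ A (k + N) ∩ B (k + N)} :=
      fun ω hω k _ => hω (k + N) (Nat.le_add_left N k)
    exact (measureReal_mono hsubset).trans
      (measureReal_forall_notMem_inter_le (fun k => hA (k + N)) (fun k => hB (k + N))
        (hind.comp_of_injective (add_left_injective N)) (fun k => hAB (k + N)) _ hM)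
  rw [← ofReal_measureReal]
  exact ENNReal.ofReal_le_ofReal hle

end BorelCantelli

/-! ### Sums of inverse distances on the circle -/

section InverseDistance

lemma integral_inv_max {r b : ℝ} (hr : 0 < r) (hb : r ≤ b) :
    ∫ x in 0..b, (max r x)⁻¹ = 1 + Real.log (b / r) := by
  have hcont : Continuous fun x => (max r x)⁻¹ :=
    (continuous_const.max continuous_id).inv₀ fun x => (lt_max_of_lt_left hr).ne'
  have hnear : ∫ x in 0..r, (max r x)⁻¹ = 1 := by
    rw [intervalIntegral.integral_congr (g := fun _ => r⁻¹) fun x hx => ?_]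
    · simp [hr.ne']
    · rw [Set.uIcc_of_le hr.le] at hx
      simp only [max_eq_left hx.2]
  have hfar : ∫ x in r..b, (max r x)⁻¹ = Real.log (b / r) := by
    rw [← integral_inv_of_pos hr (hr.trans_le hb)]
    refine intervalIntegral.integral_congr fun x hx => ?_
    rw [Set.uIcc_of_le hb] at hx
    simp only [max_eq_right hx.1]
  rw [← intervalIntegral.integral_add_adjacent_intervals (hcont.intervalIntegrable 0 r)
    (hcont.intervalIntegrable r b), hnear, hfar]

lemma continuous_inv_max_norm {r : ℝ} (hr : 0 < r) :
    Continuous fun v : UnitAddCircle => (max r ‖v‖)⁻¹ :=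
  (continuous_const.max continuous_norm).inv₀ fun _ => (lt_max_of_lt_left hr).ne'

lemma integral_inv_max_norm {r : ℝ} (hr : 0 < r) (hr2 : r ≤ 1 / 2) :
    ∫ v : UnitAddCircle, (max r ‖v‖)⁻¹ = 2 * (1 + Real.log (1 / 2 / r)) := by
  have hnorm {x : ℝ} (hx : x ∈ Set.uIcc (-(1 / 2)) (1 / 2 : ℝ)) :
      ‖(x : UnitAddCircle)‖ = |x| := by
    rw [Set.uIcc_of_le (by norm_num)] at hx
    exact (AddCircle.norm_coe_eq_abs_iff 1 one_ne_zero).2 (by simpa using abs_le.2 hx)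
  have hcont : Continuous fun x : ℝ => (max r |x|)⁻¹ :=
    (continuous_const.max continuous_abs).inv₀ fun _ => (lt_max_of_lt_left hr).ne'
  have hright : ∫ x in 0..(1 / 2), (max r |x|)⁻¹ = 1 + Real.log (1 / 2 / r) := by
    rw [← integral_inv_max hr hr2]
    refine intervalIntegral.integral_congr fun x hx => ?_
    rw [Set.uIcc_of_le (by norm_num)] at hx
    simp only [abs_of_nonneg hx.1]
  have hleft : ∫ x in (-(1 / 2))..0, (max r |x|)⁻¹ = ∫ x in 0..(1 / 2), (max r |x|)⁻¹ := by
    simpa only [abs_neg, neg_zero] using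
      (intervalIntegral.integral_comp_neg (a := 0) (b := 1 / 2) fun x => (max r |x|)⁻¹).symm
  calc ∫ v : UnitAddCircle, (max r ‖v‖)⁻¹
      = ∫ x in (-(1 / 2))..(-(1 / 2) + 1), (max r ‖(x : UnitAddCircle)‖)⁻¹ :=
        (AddCircle.intervalIntegral_preimage 1 (-(1 / 2)) _).symm
    _ = ∫ x in (-(1 / 2))..(1 / 2), (max r |x|)⁻¹ := by
        rw [show (-(1 / 2) + 1 : ℝ) = 1 / 2 by norm_num]
        exact intervalIntegral.integral_congr fun x hx => by simp only [hnorm hx]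
    _ = 2 * (1 + Real.log (1 / 2 / r)) := by
        rw [← intervalIntegral.integral_add_adjacent_intervals (hcont.intervalIntegrable _ 0)
          (hcont.intervalIntegrable 0 _), hleft, hright, two_mul]

lemma volume_real_closedBall_circle {r : ℝ} (h0 : 0 ≤ r) (h2 : r ≤ 1 / 2) (x : UnitAddCircle) :
    volume.real (Metric.closedBall x r) = 2 * r := by
  rw [Measure.real, AddCircle.volume_closedBall, min_eq_right (by linarith),
    ENNReal.toReal_ofReal (by linarith)]

/-- The growth rate `n (1 + log n)` of the sum of the inverse distances to `0` of `n` uniformly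
distributed points of the circle. -/
def logScale (n : ℕ) : ℝ := n * (1 + Real.log n)

lemma le_logScale (n : ℕ) : n ≤ logScale n :=
  le_mul_of_one_le_right n.cast_nonneg (by linarith [Real.log_natCast_nonneg n])

lemma not_summable_inv_logScale : ¬ Summable fun n => (logScale n)⁻¹ := by
  have hanti ⦃m n : ℕ⦄ (hm : 0 < m) (hmn : m ≤ n) : (logScale n)⁻¹ ≤ (logScale m)⁻¹ := by
    have hmn' : (m : ℝ) ≤ n := Nat.cast_le.2 hmn
    have hm' : (0 : ℝ) < m := Nat.cast_pos.2 hm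
    refine inv_anti₀ (hm'.trans_le (le_logScale m)) ?_
    exact mul_le_mul hmn' (by gcongr) (by linarith [Real.log_natCast_nonneg m]) n.cast_nonneg
  rw [← summable_condensed_iff_of_nonneg
    (fun n => inv_nonneg.2 (n.cast_nonneg.trans (le_logScale n))) hanti]
  intro hsum
  have hharmonic : Summable fun k : ℕ => ((k + 1 : ℕ) : ℝ)⁻¹ := by
    refine hsum.of_nonneg_of_le (fun k => by positivity) fun k => ?_
    rw [logScale, Nat.cast_pow, Nat.cast_ofNat, Real.log_pow, mul_inv,
      mul_inv_cancel_left₀ (by positivity), Nat.cast_add_one]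
    refine inv_anti₀ (add_pos_of_pos_of_nonneg one_pos
      (mul_nonneg k.cast_nonneg (Real.log_nonneg one_le_two))) ?_
    nlinarith [Real.log_two_lt_d9, (Nat.cast_nonneg k : (0 : ℝ) ≤ k)]
  exact Real.not_summable_natCast_inv ((summable_nat_add_iff 1).1 hharmonic)

variable {Ω ι : Type*} [MeasurableSpace Ω] {μ : Measure Ω} {W : ι → Ω → UnitAddCircle}

lemma measureReal_exists_norm_le (hW : ∀ i, MeasurePreserving (W i) μ volume) (s : Finset ι)
    {r : ℝ} (hr : 0 ≤ r) (hr2 : r ≤ 1 / 2) :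
    μ.real {ω | ∃ i ∈ s, ‖W i ω‖ ≤ r} ≤ s.card * (2 * r) := by
  have hunion : {ω | ∃ i ∈ s, ‖W i ω‖ ≤ r} = ⋃ i ∈ s, W i ⁻¹' Metric.closedBall 0 r := by
    ext ω
    simp
  rw [hunion, ← nsmul_eq_mul, ← volume_real_closedBall_circle hr hr2 0]
  refine (measureReal_biUnion_finset_le _ _).trans (Finset.sum_le_card_nsmul _ _ _ fun i _ => ?_)
  exact ((hW i).measureReal_preimage measurableSet_closedBall.nullMeasurableSet).le

lemma integral_sum_inv_max_norm (hW : ∀ i, MeasurePreserving (W i) μ volume) (s : Finset ι)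
    {r : ℝ} (hr : 0 < r) (hr2 : r ≤ 1 / 2) :
    Integrable (fun ω => ∑ i ∈ s, (max r ‖W i ω‖)⁻¹) μ ∧
      ∫ ω, ∑ i ∈ s, (max r ‖W i ω‖)⁻¹ ∂μ = s.card * (2 * (1 + Real.log (1 / 2 / r))) := by
  have hcont := continuous_inv_max_norm hr
  have hint (i : ι) : Integrable (fun ω => (max r ‖W i ω‖)⁻¹) μ :=
    (hW i).integrable_comp_of_integrable (integrable_of_continuous hcont)
  refine ⟨integrable_finsetSum _ fun i _ => hint i, ?_⟩
  rw [integral_finsetSum _ fun i _ => hint i, ← nsmul_eq_mul, ← integral_inv_max_norm hr hr2,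
    ← Finset.sum_const]
  refine Finset.sum_congr rfl fun i _ => ?_
  rw [← (hW i).map_eq, integral_map (hW i).measurable.aemeasurable hcont.aestronglyMeasurable]

/-- The inverse distance to `0` is not integrable, so it is truncated at the level `r⁻¹`. -/
lemma measureReal_lt_sum_inv_norm_le [IsFiniteMeasure μ]
    (hW : ∀ i, MeasurePreserving (W i) μ volume) (s : Finset ι) {r L : ℝ} (hr : 0 < r)
    (hr2 : r ≤ 1 / 2) (hL : 0 < L) :
    μ.real {ω | L < ∑ i ∈ s, ‖W i ω‖⁻¹} ≤
      s.card * (2 * r) + s.card * (2 * (1 + Real.log (1 / 2 / r))) / L := by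
  have hmarkov : μ.real {ω | L ≤ ∑ i ∈ s, (max r ‖W i ω‖)⁻¹} ≤
      s.card * (2 * (1 + Real.log (1 / 2 / r))) / L := by
    obtain ⟨hint, hmean⟩ := integral_sum_inv_max_norm hW s hr hr2
    rw [le_div_iff₀' hL, ← hmean]
    exact mul_meas_ge_le_integral_of_nonneg
      (Eventually.of_forall fun ω => Finset.sum_nonneg fun i _ => by positivity) hint L
  refine (measureReal_mono fun ω hω => ?_).trans ((measureReal_union_le _ _).trans
    (add_le_add (measureReal_exists_norm_le hW s hr.le hr2) hmarkov))
  refine or_iff_not_imp_left.2 fun hfar => ?_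
  simp only [Set.mem_ofPred_eq, not_exists, not_and, not_le] at hω hfar ⊢
  refine hω.le.trans_eq (Finset.sum_congr rfl fun i hi => ?_)
  rw [max_eq_right (hfar i hi).le]

theorem exists_measureReal_lt_sum_inv_norm_le [IsFiniteMeasure μ]
    (hW : ∀ i, MeasurePreserving (W i) μ volume) {δ : ℝ} (hδ : 0 < δ) (hδ1 : δ ≤ 1) :
    ∃ C, 0 < C ∧ ∀ s : Finset ι, s.Nonempty →
      μ.real {ω | C * logScale s.card < ∑ i ∈ s, ‖W i ω‖⁻¹} ≤ δ := by
  have hlogδ : 0 ≤ Real.log (2 / δ) := Real.log_nonneg (by rw [le_div_iff₀ hδ]; linarith)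
  refine ⟨4 * (1 + Real.log (2 / δ)) / δ, by positivity, fun s hs => ?_⟩
  have hN : (1 : ℝ) ≤ s.card := Nat.one_le_cast.2 hs.card_pos
  have hscale : 0 < logScale s.card := (zero_lt_one.trans_le hN).trans_le (le_logScale _)
  have hlogN := Real.log_natCast_nonneg s.card
  refine (measureReal_lt_sum_inv_norm_le hW s (r := δ / (4 * s.card)) (by positivity)
    (by rw [div_le_iff₀ (by positivity)]; linarith) (by positivity)).trans ?_
  have hclose : s.card * (2 * (δ / (4 * s.card))) = δ / 2 := by
    field_simp
    norm_num
  have hfar : s.card * (2 * (1 + Real.log (1 / 2 / (δ / (4 * s.card))))) /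
      (4 * (1 + Real.log (2 / δ)) / δ * logScale s.card) ≤ δ / 2 := by
    have hlog : Real.log (1 / 2 / (δ / (4 * s.card))) = Real.log (2 / δ) + Real.log s.card := by
      rw [← Real.log_mul (by positivity) (by positivity)]
      congr 1
      field_simp
      norm_num
    have hδ2 : δ / 2 * (4 * (1 + Real.log (2 / δ)) / δ * logScale s.card) =
        s.card * (2 * ((1 + Real.log (2 / δ)) * (1 + Real.log s.card))) := by
      rw [logScale]
      field_simp
      norm_num
    rw [div_le_iff₀ (by positivity), hδ2, hlog]
    gcongr
    nlinarith [mul_nonneg hlogδ hlogN]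
  rw [hclose]
  linarith

end InverseDistance

/-! ### Dominance is typical -/

section Dominance

open ProbabilityTheory

lemma indepFun_of_surjective_prod {G H K : Type*} [AddGroup G] [TopologicalSpace G]
    [IsTopologicalAddGroup G] [MeasurableSpace G] [BorelSpace G]
    [AddGroup H] [TopologicalSpace H] [IsTopologicalAddGroup H] [CompactSpace H]
    [MeasurableSpace H] [BorelSpace H]
    [AddGroup K] [TopologicalSpace K] [IsTopologicalAddGroup K] [CompactSpace K]
    [SecondCountableTopology K] [MeasurableSpace K] [BorelSpace K]
    {μ : Measure G} [μ.IsAddHaarMeasure] [IsProbabilityMeasure μ] {f : G →+ H} {g : G →+ K}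
    (hf : Continuous f) (hg : Continuous g) (hfg : Function.Surjective (f.prod g)) :
    IndepFun f g μ := by
  have hmapf := Measure.isAddHaarMeasure_map_of_isFiniteMeasure μ f hf
    (Prod.fst_surjective.comp hfg)
  have hmapg := Measure.isAddHaarMeasure_map_of_isFiniteMeasure μ g hg
    (Prod.snd_surjective.comp hfg)
  have : IsProbabilityMeasure (μ.map f) := Measure.isProbabilityMeasure_map hf.aemeasurable
  have : IsProbabilityMeasure (μ.map g) := Measure.isProbabilityMeasure_map hg.aemeasurable
  rw [indepFun_iff_map_prod_eq_prod_map_map hf.aemeasurable hg.aemeasurable]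
  exact (AddMonoidHom.measurePreserving (hf.prodMk hg) hfg
    (by rw [measure_univ, measure_univ])).map_eq

/-- The point `u + k α` of the orbit of `u` under the rotation by `α`, as a homomorphism in
`(α, u, v)`. -/
def orbitFst (k : ℤ) : UnitAddCircle × Torus2 →+ UnitAddCircle :=
  (AddMonoidHom.fst _ _).comp (AddMonoidHom.snd _ _) + k • AddMonoidHom.fst _ _

/-- The point `v + k α` of the orbit of `v` under the rotation by `α`, as a homomorphism in
`(α, u, v)`. -/
def orbitSnd (k : ℤ) : UnitAddCircle × Torus2 →+ UnitAddCircle :=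
  (AddMonoidHom.snd _ _).comp (AddMonoidHom.snd _ _) + k • AddMonoidHom.fst _ _

lemma orbitFst_apply (k : ℤ) (ω : UnitAddCircle × Torus2) : orbitFst k ω = ω.2.1 + k • ω.1 :=
  rfl

lemma orbitSnd_apply (k : ℤ) (ω : UnitAddCircle × Torus2) : orbitSnd k ω = ω.2.2 + k • ω.1 :=
  rfl

lemma continuous_orbitFst (k : ℤ) : Continuous (orbitFst k) :=
  (by fun_prop : Continuous fun ω : UnitAddCircle × Torus2 => ω.2.1 + k • ω.1)

lemma continuous_orbitSnd (k : ℤ) : Continuous (orbitSnd k) :=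
  (by fun_prop : Continuous fun ω : UnitAddCircle × Torus2 => ω.2.2 + k • ω.1)

instance : Measure.IsAddHaarMeasure (volume : Measure (UnitAddCircle × Torus2)) :=
  Measure.prod.instIsAddHaarMeasure volume volume

lemma measurePreserving_orbitFst (k : ℤ) : MeasurePreserving (orbitFst k) volume volume :=
  AddMonoidHom.measurePreserving (continuous_orbitFst k)
    (fun y => ⟨(0, y, 0), by simp [orbitFst_apply]⟩) (by rw [measure_univ, measure_univ])

lemma measurePreserving_orbitSnd (k : ℤ) : MeasurePreserving (orbitSnd k) volume volume :=
  AddMonoidHom.measurePreserving (continuous_orbitSnd k)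
    (fun y => ⟨(0, 0, y), by simp [orbitSnd_apply]⟩) (by rw [measure_univ, measure_univ])

lemma indepFun_orbitFst {m n : ℤ} (hmn : m ≠ n) : IndepFun (orbitFst m) (orbitFst n) volume := by
  refine indepFun_of_surjective_prod (continuous_orbitFst m) (continuous_orbitFst n) ?_
  rintro ⟨s, t⟩
  obtain ⟨α, hα⟩ := DivisibleBy.surjective_smul UnitAddCircle ℤ (sub_ne_zero.2 hmn) (s - t)
  refine ⟨(α, s - m • α, 0), Prod.ext (by simp [orbitFst_apply]) ?_⟩
  simp only [sub_smul] at hα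
  simp [orbitFst_apply, sub_add, hα]

lemma indepFun_orbitFst_snd (n : ℤ) :
    IndepFun (orbitFst n)
      ((AddMonoidHom.fst _ _).prod ((AddMonoidHom.snd _ _).comp (AddMonoidHom.snd _ _)) :
        UnitAddCircle × Torus2 →+ Torus2) volume := by
  refine indepFun_of_surjective_prod (continuous_orbitFst n) ?_ ?_
  · exact continuous_fst.prodMk (continuous_snd.comp continuous_snd)
  · exact fun ⟨s, α, v⟩ => ⟨(α, s - n • α, v), by simp [orbitFst_apply]⟩

/-- The event that the `n`-th passage near the first point is closer than typical by a factor of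
order `log n`. -/
def hitEvent (η : ℝ) (n : ℕ) : Set (UnitAddCircle × Torus2) :=
  {ω | ‖ω.2.1 + (n : ℤ) • ω.1‖ ≤ η / logScale (n + 3)}

/-- The event that the sum of the inverse distances of the passages `-1, …, n + 1` near the second
point is of its typical order. -/
def tameEvent (C : ℝ) (n : ℕ) : Set (UnitAddCircle × Torus2) :=
  {ω | crossingSum ω.1 ω.2.2 n ≤ C * logScale (n + 3)}

variable {η C δ : ℝ} {n : ℕ}

lemma one_le_logScale (n : ℕ) : 1 ≤ logScale (n + 1) :=
  (Nat.one_le_cast.2 (Nat.le_add_left 1 n)).trans (le_logScale (n + 1))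

lemma hitEvent_eq_preimage (η : ℝ) (n : ℕ) :
    hitEvent η n = orbitFst n ⁻¹' Metric.closedBall 0 (η / logScale (n + 3)) := by
  ext ω
  rw [Set.mem_preimage, mem_closedBall_zero_iff]
  rfl

lemma measurableSet_hitEvent (η : ℝ) (n : ℕ) : MeasurableSet (hitEvent η n) := by
  rw [hitEvent_eq_preimage]
  exact measurableSet_closedBall.preimage (continuous_orbitFst n).measurable

lemma measurableSet_crossingSum_le (c : ℝ) (n : ℕ) :
    MeasurableSet {z : Torus2 | crossingSum z.1 z.2 n ≤ c} :=
  measurableSet_le (Finset.measurable_sum _ fun k _ => Measurable.inv (Measurable.norm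
    (by fun_prop))) measurable_const

lemma measurableSet_tameEvent (C : ℝ) (n : ℕ) : MeasurableSet (tameEvent C n) :=
  (measurableSet_crossingSum_le (C * logScale (n + 3)) n).preimage
    (f := fun ω : UnitAddCircle × Torus2 => (ω.1, ω.2.2))
    (measurable_fst.prodMk (measurable_snd.comp measurable_snd))

lemma measureReal_hitEvent (h0 : 0 ≤ η) (h2 : η ≤ 1 / 2) (n : ℕ) :
    volume.real (hitEvent η n) = 2 * (η / logScale (n + 3)) := by
  have hscale := one_le_logScale (n + 2)
  rw [hitEvent_eq_preimage, (measurePreserving_orbitFst n).measureReal_preimage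
    measurableSet_closedBall.nullMeasurableSet]
  exact volume_real_closedBall_circle (by positivity) ((div_le_self h0 hscale).trans h2) 0

lemma not_summable_measureReal_hitEvent (h0 : 0 < η) (h2 : η ≤ 1 / 2) :
    ¬ Summable fun n => volume.real (hitEvent η n) := by
  simp_rw [measureReal_hitEvent h0.le h2, div_eq_mul_inv]
  rw [summable_mul_left_iff two_ne_zero, summable_mul_left_iff h0.ne',
    summable_nat_add_iff (f := fun n => (logScale n)⁻¹) 3]
  exact not_summable_inv_logScale

lemma indepSet_hitEvent (η : ℝ) :
    Pairwise fun m n => IndepSet (hitEvent η m) (hitEvent η n) volume := by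
  intro m n hmn
  simp only [hitEvent_eq_preimage]
  exact (indepFun_iff_indepSet_preimage (continuous_orbitFst m).measurable
    (continuous_orbitFst n).measurable).1 (indepFun_orbitFst (Nat.cast_injective.ne hmn)) _ _
      measurableSet_closedBall measurableSet_closedBall

lemma indepSet_hitEvent_tameEvent (η C : ℝ) (n : ℕ) :
    IndepSet (hitEvent η n) (tameEvent C n)ᶜ volume := by
  rw [hitEvent_eq_preimage]
  exact (indepFun_iff_indepSet_preimage (continuous_orbitFst n).measurable
    (continuous_fst.prodMk (continuous_snd.comp continuous_snd)).measurable).1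
    (indepFun_orbitFst_snd n) _ _ measurableSet_closedBall
    (measurableSet_crossingSum_le (C * logScale (n + 3)) n).compl

lemma exists_measureReal_compl_tameEvent_le (hδ : 0 < δ) (hδ1 : δ ≤ 1) :
    ∃ C, 0 < C ∧ ∀ n, volume.real (tameEvent C n)ᶜ ≤ δ := by
  obtain ⟨C, hC, hle⟩ := exists_measureReal_lt_sum_inv_norm_le measurePreserving_orbitSnd hδ hδ1
  refine ⟨C, hC, fun n => ?_⟩
  have hcard : (Finset.Icc (-1 : ℤ) (n + 1)).card = n + 3 := by
    rw [Int.card_Icc]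
    lia
  have hcompl : (tameEvent C n)ᶜ = {ω | C * logScale (Finset.Icc (-1 : ℤ) (n + 1)).card <
      ∑ k ∈ Finset.Icc (-1 : ℤ) (n + 1), ‖orbitSnd k ω‖⁻¹} := by
    rw [hcard]
    exact Set.ext fun ω => not_le (a := crossingSum ω.1 ω.2.2 n)
  rw [hcompl]
  exact hle _ (Finset.card_pos.1 (by lia))

lemma norm_mul_crossingSum_le (hη : 0 ≤ η) {ω : UnitAddCircle × Torus2}
    (hω : ω ∈ hitEvent η n ∩ tameEvent C n) :
    ‖ω.2.1 + (n : ℤ) • ω.1‖ * crossingSum ω.1 ω.2.2 n ≤ η * C := by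
  have hscale := one_le_logScale (n + 2)
  calc ‖ω.2.1 + (n : ℤ) • ω.1‖ * crossingSum ω.1 ω.2.2 n
      ≤ η / logScale (n + 3) * (C * logScale (n + 3)) :=
        mul_le_mul hω.1 hω.2 (crossingSum_nonneg _ _ _) (by positivity)
    _ = η * C := by field_simp

lemma measure_not_frequently_lt_le {ε : ℝ} (hε : 0 < ε) (hδ : 0 < δ) (hδ1 : δ ≤ 1) :
    volume {ω : UnitAddCircle × Torus2 |
      ¬ ∃ᶠ n : ℕ in atTop, ‖ω.2.1 + (n : ℤ) • ω.1‖ * crossingSum ω.1 ω.2.2 n < ε} ≤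
      ENNReal.ofReal (2 * δ) := by
  obtain ⟨C, hC, htame⟩ := exists_measureReal_compl_tameEvent_le hδ hδ1
  obtain ⟨η, hη, hη2, hηC⟩ : ∃ η, 0 < η ∧ η ≤ 1 / 2 ∧ η * C < ε :=
    ⟨min (1 / 2) (ε / (2 * C)), by positivity, min_le_left _ _, by
      grw [min_le_right]
      rw [div_mul_eq_mul_div, div_lt_iff₀ (by positivity)]
      linarith [mul_pos hε hC]⟩
  have hsubset : {ω : UnitAddCircle × Torus2 |
      ¬ ∃ᶠ n : ℕ in atTop, ‖ω.2.1 + (n : ℤ) • ω.1‖ * crossingSum ω.1 ω.2.2 n < ε} ⊆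
      {ω | ¬ ∃ᶠ n in atTop, ω ∈ hitEvent η n ∩ tameEvent C n} :=
    fun ω hω hfreq => hω (hfreq.mono fun n hn =>
      (norm_mul_crossingSum_le hη.le hn).trans_lt hηC)
  refine (measure_mono hsubset).trans
    (measure_not_frequently_mem_inter_le (measurableSet_hitEvent η) (measurableSet_tameEvent C)
      (indepSet_hitEvent η) (fun n => ?_) (not_summable_measureReal_hitEvent hη hη2))
  rw [Set.sdiff_eq, measureReal_def,
    (indepSet_hitEvent_tameEvent η C n).measure_inter_eq_mul, ENNReal.toReal_mul, mul_comm]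
  exact mul_le_mul_of_nonneg_right (htame n) measureReal_nonneg

lemma ae_frequently_lt {ε : ℝ} (hε : 0 < ε) :
    ∀ᵐ ω : UnitAddCircle × Torus2,
      ∃ᶠ n : ℕ in atTop, ‖ω.2.1 + (n : ℤ) • ω.1‖ * crossingSum ω.1 ω.2.2 n < ε := by
  have hlim : Tendsto (fun δ : ℝ => ENNReal.ofReal (2 * δ)) (𝓝[>] 0) (𝓝 0) := by
    refine tendsto_nhdsWithin_of_tendsto_nhds ?_
    have hcont : Continuous fun δ : ℝ => ENNReal.ofReal (2 * δ) :=
      ENNReal.continuous_ofReal.comp (continuous_const_mul 2)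
    simpa using hcont.tendsto 0
  refine ae_iff.2 (le_antisymm (ge_of_tendsto hlim ?_) bot_le)
  filter_upwards [Ioc_mem_nhdsGT one_pos] with δ hδ
  exact measure_not_frequently_lt_le hε hδ.1 hδ.2

instance : NullSingletonClass (volume : Measure UnitAddCircle) :=
  ⟨fun y => by
    rw [← Metric.closedBall_zero, AddCircle.volume_closedBall, mul_zero, min_eq_right zero_le_one,
      ENNReal.ofReal_zero]⟩

theorem ae_isDominant : ∀ᵐ ω : UnitAddCircle × Torus2, IsDominant ω.1 ω.2.1 ω.2.2 := by
  have hne : ∀ᵐ y : UnitAddCircle, y ≠ 0 := Measure.ae_ne volume 0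
  have hfreq (m : ℕ) := ae_frequently_lt (Nat.one_div_pos_of_nat (α := ℝ) (n := m))
  have hleft (k : ℤ) := (measurePreserving_orbitFst k).quasiMeasurePreserving.ae hne
  have hright (k : ℤ) := (measurePreserving_orbitSnd k).quasiMeasurePreserving.ae hne
  filter_upwards [ae_all_iff.2 hleft, ae_all_iff.2 hright, ae_all_iff.2 hfreq] with ω hu hv hω
  refine ⟨hu, hv, fun ε hε => ?_⟩
  obtain ⟨m, hm⟩ := exists_nat_one_div_lt hε
  exact (hω m).mono fun n hn => hn.trans hm

end Dominance

/-! ### Typical parameters -/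

section Transfer

lemma measurable_equivIco : Measurable fun y : UnitAddCircle => (AddCircle.equivIco 1 0 y : ℝ) :=
  measurable_subtype_coe.comp (AddCircle.measurableEquivIco 1 0).measurable

lemma measurable_crossing (k : ℤ) : Measurable fun w : ℝ × Torus2 => crossing w.1 w.2 k := by
  have htime : Measurable fun w : ℝ × Torus2 => w.1 * crossingTime w.2 k :=
    measurable_fst.mul ((measurable_equivIco.comp
      (measurable_fst.comp measurable_snd)).add_const _)
  exact (AddCircle.measurable_mk'.comp htime).sub (measurable_snd.comp measurable_snd)

lemma measurePreserving_crossing (a : ℝ) (k : ℤ) :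
    MeasurePreserving (fun z => crossing a z k) volume volume := by
  have hsection (y : UnitAddCircle) : MeasurePreserving (fun z => crossing a (y, z) k)
      volume volume :=
    Measure.measurePreserving_sub_left volume ((a * crossingTime (y, 0) k : ℝ) : UnitAddCircle)
  have hgraph : MeasurePreserving (fun z : Torus2 => (z.1, crossing a z k)) volume volume :=
    MeasurePreserving.skew_product (MeasurePreserving.id volume)
      (g := fun z₁ z₂ => crossing a (z₁, z₂) k)
      ((measurable_crossing k).comp (measurable_const.prodMk measurable_id))
      (Eventually.of_forall fun y => (hsection y).map_eq)
  exact measurePreserving_snd.comp hgraph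

lemma measurePreserving_crossing_sub (a : ℝ) (x : Torus2) (k : ℤ) :
    MeasurePreserving (fun p => crossing a (p - x) k) volume volume :=
  (measurePreserving_crossing a k).comp (measurePreserving_sub_right volume x)

/-- The first crossings, as seen from the zeros `p` and `q`, of the line of slope `f α` starting
at `x`, together with `α`, as a function of `(x, α, p, q)`. -/
def crossings (f : UnitAddCircle → ℝ) (w : Torus2 × UnitAddCircle × Torus2 × Torus2) :
    UnitAddCircle × Torus2 :=
  (w.2.1, crossing (f w.2.1) (w.2.2.1 - w.1) 0, crossing (f w.2.1) (w.2.2.2 - w.1) 0)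

variable {f : UnitAddCircle → ℝ}

lemma measurable_crossings (hf : Measurable f) : Measurable (crossings f) :=
  (measurable_fst.comp measurable_snd).prodMk
    (((measurable_crossing 0).comp (Measurable.prodMk (by fun_prop) (by fun_prop))).prodMk
      ((measurable_crossing 0).comp (Measurable.prodMk (by fun_prop) (by fun_prop))))

lemma measurePreserving_crossings (hf : Measurable f) :
    MeasurePreserving (crossings f) volume volume := by
  have hsection (x : Torus2) : MeasurePreserving (fun ω => crossings f (x, ω)) volume volume :=
    MeasurePreserving.skew_product (MeasurePreserving.id volume)
      (g := fun α (w : Torus2 × Torus2) =>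
        (crossing (f α) (w.1 - x) 0, crossing (f α) (w.2 - x) 0))
      (measurable_snd.comp ((measurable_crossings hf).comp
        (measurable_const.prodMk measurable_id)))
      (Eventually.of_forall fun _ => ((measurePreserving_crossing_sub _ x 0).prod
        (measurePreserving_crossing_sub _ x 0)).map_eq)
  have hgraph : MeasurePreserving
      (fun w : Torus2 × UnitAddCircle × Torus2 × Torus2 => (w.1, crossings f w)) volume volume :=
    MeasurePreserving.skew_product (MeasurePreserving.id volume)
      (g := fun x ω => crossings f (x, ω)) (measurable_crossings hf)
      (Eventually.of_forall fun x => (hsection x).map_eq)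
  exact measurePreserving_snd.comp hgraph

lemma ae_ae_isDominant_crossing (hf : Measurable f) :
    ∀ᵐ ω : UnitAddCircle × Torus2 × Torus2, ∀ᵐ x : Torus2,
      IsDominant ω.1 (crossing (f ω.1) (ω.2.1 - x) 0) (crossing (f ω.1) (ω.2.2 - x) 0) :=
  Measure.ae_ae_of_ae_prod (((measurePreserving_crossings hf).comp
    Measure.measurePreserving_swap).quasiMeasurePreserving.ae ae_isDominant)

lemma ae_irrational : ∀ᵐ α : UnitAddCircle, ∀ a : ℝ, (a : UnitAddCircle) = α → Irrational a := by
  filter_upwards [(Set.countable_range fun r : ℚ => ((r : ℝ) : UnitAddCircle)).ae_notMem volume]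
    with α hα
  rintro _ rfl ⟨r, rfl⟩
  exact hα ⟨r, rfl⟩

lemma eq_equivIco_add_intCast (a : ℝ) :
    ∃ m : ℤ, a = AddCircle.equivIco 1 0 (a : UnitAddCircle) + m :=
  ⟨⌊a⌋, by simp⟩

/-- The parameters `(α, p, q)` such that every real representative `a` of `α` is irrational and,
from almost every `x`, the passages of the line of slope `a` near each of `p` and `q` infinitely
often dominate the previous ones near the other. -/
def goodParams : Set (UnitAddCircle × Torus2 × Torus2) :=
  {ω | ∀ a : ℝ, (a : UnitAddCircle) = ω.1 → Irrational a ∧ ∀ᵐ x : Torus2,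
    IsDominant a (crossing a (ω.2.1 - x) 0) (crossing a (ω.2.2 - x) 0) ∧
    IsDominant a (crossing a (ω.2.2 - x) 0) (crossing a (ω.2.1 - x) 0)}

lemma volume_compl_goodParams : volume goodParamsᶜ = 0 := by
  have hirr : ∀ᵐ ω : UnitAddCircle × Torus2 × Torus2,
      ∀ a : ℝ, (a : UnitAddCircle) = ω.1 → Irrational a :=
    measurePreserving_fst.quasiMeasurePreserving.ae ae_irrational
  have hdom := ae_all_iff.2 fun m : ℤ =>
    ae_ae_isDominant_crossing (measurable_equivIco.add_const (m : ℝ))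
  have hswap : MeasurePreserving
      (Prod.map id Prod.swap : UnitAddCircle × Torus2 × Torus2 → UnitAddCircle × Torus2 × Torus2)
      volume volume :=
    (MeasurePreserving.id volume).prod Measure.measurePreserving_swap
  rw [← mem_ae_iff]
  filter_upwards [hirr, hdom, hswap.quasiMeasurePreserving.ae hdom] with ω hω hpq hqp
  rintro a ha
  obtain ⟨m, hm⟩ := eq_equivIco_add_intCast a
  have hdom_and := (hpq m).and (hqp m)
  simp only [Prod.map_fst, Prod.map_snd, id_eq, Prod.fst_swap, Prod.snd_swap, ← ha, ← hm]
    at hdom_and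
  exact ⟨hω a ha, hdom_and⟩

end Transfer

variable {p q : Torus2} {φ : Torus2 → ℝ} {a : ℝ} {T : Flow ℝ Torus2}

lemma IsStoppingFunction.hasExtremeHistoricBehavior (h : IsStoppingFunction φ p q)
    (ha : Irrational a) (hT : IsGeneratedBy T φ a)
    (hdom : ∀ᵐ x : Torus2, IsDominant a (crossing a (p - x) 0) (crossing a (q - x) 0) ∧
      IsDominant a (crossing a (q - x) 0) (crossing a (p - x) 0)) :
    HasExtremeHistoricBehavior T := by
  filter_upwards [hdom] with x ⟨hpq, hqp⟩
  rw [h.invariantMeasures_eq ha hT]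
  exact (h.accumulationMeasures_subset ha hT x).antisymm (h.diracSegment_subset ha hT
    (fun g hg ε hε => hpq.frequently_empirical_lt h hT hg hε)
    (fun g hg ε hε => hqp.frequently_empirical_lt h.symm hT hg hε))

end TorusFlow

end

/-- There is a full-measure set `F` of parameters `(α, p, q)` such that for every `(α, p, q)` in `F`,
every real representative `a` of `α` and every `C³` non-negative `φ` with exactly the two
non-degenerate zeros `p` and `q`, the vector field `φ · (1, a)` generates a flow, and this flow
has extreme historic behavior, its invariant probability measures being exactly the convex
combinations of `δ_p` and `δ_q`. -/
theorem mainTheorem4 :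
    ∃ F : Set (UnitAddCircle × TorusFlow.Torus2 × TorusFlow.Torus2),
      MeasureTheory.volume Fᶜ = 0 ∧
      ∀ (α : UnitAddCircle) (p q : TorusFlow.Torus2), (α, p, q) ∈ F →
        ∀ a : ℝ, (a : UnitAddCircle) = α →
        ∀ φ : TorusFlow.Torus2 → ℝ, TorusFlow.IsStoppingFunction φ p q →
          (∃ T : Flow ℝ TorusFlow.Torus2, TorusFlow.IsGeneratedBy T φ a) ∧
          ∀ T : Flow ℝ TorusFlow.Torus2, TorusFlow.IsGeneratedBy T φ a →
            TorusFlow.HasExtremeHistoricBehavior T ∧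
            TorusFlow.invariantMeasures T = TorusFlow.diracSegment p q := by
  refine ⟨TorusFlow.goodParams, TorusFlow.volume_compl_goodParams, ?_⟩
  intro α p q hF a ha φ hφ
  obtain ⟨hirr, hdom⟩ := hF a ha
  exact ⟨hφ.exists_isGeneratedBy a, fun T hT =>
    ⟨hφ.hasExtremeHistoricBehavior hirr hT hdom, hφ.invariantMeasures_eq hirr hT⟩⟩
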